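/- Let $\mathbb H_{\mathbb R}$ and $\mathbb H_{\mathbb C}$ be the quaternions with real and with complex coefficients (the complex unit $i$ commutes with the quaternionic units, and $|\cdot|$ on $\mathbb H_{\mathbb C}$ is the Euclidean norm of $\mathbb C^4$). For $q=a+v\in\mathbb H_{\mathbb R}$ with scalar part $a=\mathrm{Sc}(q)$ and vector part $v$, and for $z\in\mathbb C$, put $z^q:=z^a\bigl[\cos(|v|\log z)+\tfrac{v}{|v|}\sin(|v|\log z)\bigr]\in\mathbb H_{\mathbb C}$ (principal branch; the second term is $0$ if $v=0$), $t_+^q:=t^q$ for $t>0$ and $t_+^q:=0$ for $t\le 0$. Further let $\binom qk:=\frac{q(q-1)\cdots(q-k+1)}{k!}$ and, for $a>0$, $\Gamma(q):=\int_0^\infty t^{a-1}\cos(|v|\log t)e^{-t}\,dt+\tfrac{v}{|v|}\int_0^\infty t^{a-1}\sin(|v|\log t)e^{-t}\,dt$. Let $\widehat f(\xi)=\int_{\mathbb R}f(t)e^{-i\xi t}\,dt$ denote the Fourier transform, extended to $L^2(\mathbb R,\mathbb H_{\mathbb C})$ and to $\mathbb H_{\mathbb C}$-valued tempered distributions. For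 a function $f:\mathbb R\to\mathbb H_{\mathbb C}$ put $(\nabla^qf)(t):=\sum_{k\ge0}(-1)^k\binom qk f(t-k)$ whenever the series converges. For a tempered distribution $S$ whose Fourier transform is a function, let $\mathscr D^qS$ be the tempered distribution with $\widehat{\mathscr D^qS}(\xi)=(i\xi)^q\,\widehat S(\xi)$. **Theorem.** Let $q\in\mathbb H_{\mathbb R}$ with $\mathrm{Sc}(q)>1$. There is exactly one $B_q\in L^2(\mathbb R,\mathbb H_{\mathbb C})$, the quaternionic B-spline of order $q$, such that $$\widehat{B_q}(\xi)=\Bigl(\frac{1-e^{-i\xi}}{i\xi}\Bigr)^q$$ for almost every $\xi\in\mathbb R$ (the base being $1$ at $\xi=0$). It has the following properties. 1. $\displaystyle B_q(t)=\frac1{\Gamma(q)}\sum_{k=0}^\infty(-1)^k\binom qk(t-k)_+^{q-1}$, both as an equality in $L^2(\mathbb R,\mathbb H_{\mathbb C})$ (the right-hand side is a finite sum for each $t$, and as a function of $t$ it is equal to $B_q$ almost everywhere) and in the sense of distributions (each term is a tempered distribution, and the series converges to $B_q$ in the space of tempered distributions). 2. $B_q$ satisfies $\displaystyle\mathscr D^qB_q=\sum_{k=0}^\infty(-1)^k\binom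 qk\,\delta_k$, where the series of Dirac distributions converges in the space of tempered distributions. Conversely, if $B\in L^2(\mathbb R,\mathbb H_{\mathbb C})$ satisfies $\mathscr D^qB=\sum_{k=0}^\infty(-1)^k\binom qk\,\delta_k$, then $B=B_q$. 3. $\displaystyle B_q=\frac1{\Gamma(q)}\nabla^q t_+^{q-1}$ almost everywhere. -/

import Mathlib

open MeasureTheory FourierTransform
open scoped Quaternion SchwartzMap ComplexConjugate

noncomputable section

namespace QuatSpline

/-! ### The complex quaternions as a complex Hilbert space

`ℍ[ℂ]` is the algebra of quaternions with complex coefficients; the scalar imaginary unit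
commutes with the quaternionic units. Its inner product is that of `ℂ⁴` (in Mathlib's convention,
conjugate linear in the first argument), so that `‖p‖² = |p₀|² + |p₁|² + |p₂|² + |p₃|²`. -/

/-- The inner product of `ℂ⁴` on the complex quaternions. -/
@[reducible] def innerCore : InnerProductSpace.Core ℂ ℍ[ℂ] where
  inner p r := conj p.re * r.re + conj p.imI * r.imI + conj p.imJ * r.imJ + conj p.imK * r.imK
  conj_inner_symm p r := by simp [mul_comm]
  re_inner_nonneg p := by
    simp only [map_add, RCLike.re_to_complex, Complex.mul_re, Complex.conj_re, Complex.conj_im]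
    nlinarith [mul_self_nonneg p.re.re, mul_self_nonneg p.re.im, mul_self_nonneg p.imI.re,
      mul_self_nonneg p.imI.im, mul_self_nonneg p.imJ.re, mul_self_nonneg p.imJ.im,
      mul_self_nonneg p.imK.re, mul_self_nonneg p.imK.im]
  add_left p r s := by simp; ring
  smul_left p r c := by simp; ring
  definite p h := by
    have h' := congrArg Complex.re h
    simp only [Complex.add_re, Complex.mul_re, Complex.conj_re, Complex.conj_im,
      Complex.zero_re] at h'
    have sq (x : ℝ) (hx : x * x ≤ 0) : x = 0 := mul_self_eq_zero.mp (le_antisymm hx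
      (mul_self_nonneg x))
    have n1 := mul_self_nonneg p.re.re
    have n2 := mul_self_nonneg p.re.im
    have n3 := mul_self_nonneg p.imI.re
    have n4 := mul_self_nonneg p.imI.im
    have n5 := mul_self_nonneg p.imJ.re
    have n6 := mul_self_nonneg p.imJ.im
    have n7 := mul_self_nonneg p.imK.re
    have n8 := mul_self_nonneg p.imK.im
    refine Quaternion.ext _ _ (Complex.ext ?_ ?_) (Complex.ext ?_ ?_) (Complex.ext ?_ ?_)
      (Complex.ext ?_ ?_) <;> exact sq _ (by linarith)

instance instNormedAddCommGroup : NormedAddCommGroup ℍ[ℂ] :=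
  innerCore.toNormedAddCommGroup

instance instInnerProductSpace : InnerProductSpace ℂ ℍ[ℂ] :=
  InnerProductSpace.ofCore innerCore.toCore

instance instCompleteSpace : CompleteSpace ℍ[ℂ] := FiniteDimensional.complete ℂ ℍ[ℂ]

/-- The inclusion of the real quaternions into the complex quaternions. -/
def toHC (q : ℍ[ℝ]) : ℍ[ℂ] :=
  (⟨(q.re : ℂ), (q.imI : ℂ), (q.imJ : ℂ), (q.imK : ℂ)⟩ : QuaternionAlgebra ℂ (-1) 0 (-1))

@[simp] theorem toHC_re (q : ℍ[ℝ]) : (toHC q).re = (q.re : ℂ) := rfl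

@[simp] theorem toHC_imI (q : ℍ[ℝ]) : (toHC q).imI = (q.imI : ℂ) := rfl

@[simp] theorem toHC_imJ (q : ℍ[ℝ]) : (toHC q).imJ = (q.imJ : ℂ) := rfl

@[simp] theorem toHC_imK (q : ℍ[ℝ]) : (toHC q).imK = (q.imK : ℂ) := rfl

/-! ### Quaternionic powers, Gamma function and binomial coefficients -/

/-- The normalized vector part `v / |v|` of `q = a + v` (and `0` if `v = 0`, where it only occurs
multiplied by `sin 0`). -/
def axis (q : ℍ[ℝ]) : ℍ[ℝ] := (‖q.im‖⁻¹ : ℝ) • q.im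

/-- `z ^ q = z ^ a (cos (|v| log z) + (v / |v|) sin (|v| log z))` for `z` complex and
`q = a + v` a real quaternion, with the principal branch of the logarithm. -/
def qpow (z : ℂ) (q : ℍ[ℝ]) : ℍ[ℂ] :=
  (z ^ (q.re : ℂ)) •
    (Complex.cos ((‖q.im‖ : ℂ) * Complex.log z) • (1 : ℍ[ℂ]) +
      Complex.sin ((‖q.im‖ : ℂ) * Complex.log z) • toHC (axis q))

/-- The truncated power `t₊ ^ q`. -/
def truncPow (t : ℝ) (q : ℍ[ℝ]) : ℍ[ℂ] := if 0 < t then qpow (t : ℂ) q else 0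

/-- The quaternionic Gamma function, `Γ(q) = ∫₀^∞ t ^ (q - 1) e ^ (-t) dt` for `Sc q > 0`. -/
def qGamma (q : ℍ[ℝ]) : ℍ[ℝ] :=
  (∫ t in Set.Ioi (0 : ℝ), t ^ (q.re - 1) * Real.cos (‖q.im‖ * Real.log t) * Real.exp (-t)) •
      (1 : ℍ[ℝ]) +
    (∫ t in Set.Ioi (0 : ℝ), t ^ (q.re - 1) * Real.sin (‖q.im‖ * Real.log t) * Real.exp (-t)) •
      axis q

/-- The Pochhammer symbol `q (q - 1) ⋯ (q - j + 1)`. -/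
def qpoch (q : ℍ[ℝ]) : ℕ → ℍ[ℝ]
  | 0 => 1
  | j + 1 => qpoch q j * (q - (j : ℍ[ℝ]))

/-- The binomial coefficient `q (q - 1) ⋯ (q - j + 1) / j!`. -/
def qchoose (q : ℍ[ℝ]) (j : ℕ) : ℍ[ℝ] := ((j.factorial : ℝ)⁻¹) • qpoch q j

/-- The coefficient `(-1) ^ k (q choose k)`, as a complex quaternion. -/
def coeff (q : ℍ[ℝ]) (k : ℕ) : ℍ[ℂ] := toHC ((-1) ^ k * qchoose q k)

/-- The backward difference operator `(∇^q f)(t) = ∑ₖ (-1) ^ k (q choose k) f (t - k)`. -/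
def nabla (q : ℍ[ℝ]) (f : ℝ → ℍ[ℂ]) (t : ℝ) : ℍ[ℂ] := ∑' k : ℕ, coeff q k * f (t - k)

/-! ### The quaternionic B-spline -/

/-- `Ξ(ξ) = (1 - e ^ (-iξ)) / (iξ)`, with its removable singularity at `0` removed. -/
def Xi (ξ : ℝ) : ℂ :=
  if ξ = 0 then 1 else (1 - Complex.exp (-(Complex.I * ξ))) / (Complex.I * ξ)

/-- `ξ ↦ Ξ(ξ) ^ q`. -/
def bsplineHat (q : ℍ[ℝ]) (ξ : ℝ) : ℍ[ℂ] := qpow (Xi ξ) q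

/-- The space `L²(ℝ, ℍ_ℂ)`. -/
abbrev L2HC : Type := Lp ℍ[ℂ] 2 (volume : Measure ℝ)

/-- `B ∈ L²(ℝ, ℍ_ℂ)` is the B-spline of order `q`: its Fourier–Plancherel transform
`ξ ↦ ∫ B(t) e ^ (-iξt) dt` is `Ξ ^ q`. Mathlib's transform `𝓕` has the kernel `e ^ (-2πiηt)`,
whence the substitution `ξ = 2πη`. -/
def IsBSpline (q : ℍ[ℝ]) (B : L2HC) : Prop :=
  (⇑(𝓕 B : L2HC)) =ᵐ[volume] fun η : ℝ => bsplineHat q (2 * Real.pi * η)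

/-! ### Tempered distributions with values in the complex quaternions -/

/-- The tempered distribution `T` is given by the function `f`. -/
def IsGivenBy (T : 𝓢'(ℝ, ℍ[ℂ])) (f : ℝ → ℍ[ℂ]) : Prop :=
  ∀ φ : 𝓢(ℝ, ℂ), Integrable (fun x => φ x • f x) ∧ T φ = ∫ x, φ x • f x

/-- The distribution `c δ_x : φ ↦ φ(x) c`. -/
def diracAt (x : ℝ) (c : ℍ[ℂ]) : 𝓢'(ℝ, ℍ[ℂ]) :=
  ContinuousLinearMap.toPointwiseConvergenceCLM _ _ _ _
    ((ContinuousLinearMap.toSpanSingleton ℂ c).comp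
      ((BoundedContinuousFunction.evalCLM ℂ x).comp
        (SchwartzMap.toBoundedContinuousFunctionCLM ℂ ℝ ℂ)))

theorem diracAt_apply (x : ℝ) (c : ℍ[ℂ]) (φ : 𝓢(ℝ, ℂ)) : diracAt x c φ = φ x • c := rfl

/-- `T = D^q S` for tempered distributions `S`, `T`, where the Fourier transform of `S` is a
function: `D^q` is the Fourier multiplier operator with symbol `(iξ) ^ q`, where `ξ = 2πη`. -/
def IsFracDeriv (q : ℍ[ℝ]) (S T : 𝓢'(ℝ, ℍ[ℂ])) : Prop :=
  ∃ g : ℝ → ℍ[ℂ], IsGivenBy (𝓕 S) g ∧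
    IsGivenBy (𝓕 T) fun η => qpow (Complex.I * ((2 * Real.pi * η : ℝ) : ℂ)) q * g η

/-- The distributional equation `D^q S = ∑ₖ (-1) ^ k (q choose k) δ_k`, the series being
(unconditionally) convergent in the space of tempered distributions. -/
def SolvesDeltaEquation (q : ℍ[ℝ]) (S : 𝓢'(ℝ, ℍ[ℂ])) : Prop :=
  ∃ T : 𝓢'(ℝ, ℍ[ℂ]), HasSum (fun k : ℕ => diracAt (k : ℝ) (coeff q k)) T ∧ IsFracDeriv q S T

end QuatSpline

end

open Filter Topology

noncomputable section

namespace QuatSpline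

/-! Write `q = a + v`. All quaternions in the statement lie in the commutative algebra ℂ[U], where U
is the unit vector along `v` and U² = -1. The characters U ↦ ±i identify ℂ[U] with ℂ × ℂ and send
`q` to α = a + i|v| and to its conjugate. Powers, binomial coefficients and Γ split accordingly
(`IsAxis.qpow_eq`, `IsAxis.coeff_eq`, `IsAxis.qGamma_eq`), so everything reduces to scalar splines
of complex order α with Re α > 1.

For scalar α, the Laplace transform of t₊^(α-1) is Γ(α) s^(-α), and a shift by k multiplies it by
e^(-ks). Summing with the binomial series gives Γ(α) (1 - e^(-s))^α s^(-α) for Re s > 0. This symbol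
is O((1 + |Im s|)^(-Re α)) uniformly up to the imaginary axis (`norm_symb_le`). Hence Fourier
inversion holds on each line Re s = ε, and ε → 0 yields the time domain formula
(`fourierInv_Xi_cpow`). Existence and uniqueness of the spline are Plancherel's theorem.

For the distributional equation, the coefficients are absolutely summable, so the series of Dirac
distributions converges, and its Fourier transform is (1 - e^(-iξ))^q by the binomial series on the
unit circle (`hasSum_altBinom`). Since (iξ)^q is invertible for ξ ≠ 0, the equation determines the
Fourier transform of B almost everywhere, which gives both directions at once. -/

/-! ### The binomial series on the closed unit disc -/

/-- The coefficient `(-1) ^ k (α choose k)` for a complex exponent `α`. -/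
def altBinom (α : ℂ) (k : ℕ) : ℂ :=
  (-1) ^ k * ((k.factorial : ℂ)⁻¹ * ∏ j ∈ Finset.range k, (α - j))

theorem altBinom_eq_choose (α : ℂ) (k : ℕ) : altBinom α k = (-1) ^ k * Ring.choose α k := by
  rw [altBinom, Ring.choose_eq_smul, ← descPochhammer_eval_eq_prod_range, smul_eq_mul]
  congr 2
  rw [← descPochhammer_map (Int.castRingHom ℂ), Polynomial.eval_map,
    ← Polynomial.eval₂_smulOneHom_eq_smeval]
  congr 1
  exact RingHom.ext_int _ _

theorem hasSum_altBinom_of_norm_lt_one (α : ℂ) {z : ℂ} (hz : ‖z‖ < 1) :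
    HasSum (fun k => altBinom α k * z ^ k) ((1 - z) ^ α) := by
  have h := (Complex.one_add_cpow_hasFPowerSeriesOnBall_zero (a := α)).hasSum (y := -z)
    (by simpa [enorm_eq_nnnorm, ← NNReal.coe_lt_coe] using hz)
  rw [zero_add, ← sub_eq_add_neg] at h
  refine h.congr_fun fun k => ?_
  rw [binomialSeries_apply, altBinom_eq_choose]
  simp [neg_pow z]
  ring

/-- The denominator in Euler's product for Γ(-α) is, up to sign, the falling product of α with n + 1
factors. Euler's limit therefore gives the size n^(-Re α - 1) of the coefficients. -/
theorem altBinom_succ_eq (α : ℂ) {n : ℕ} (hn : n ≠ 0) :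
    altBinom α (n + 1) = (n : ℂ) ^ (-α) / (n + 1) * (Complex.GammaSeq (-α) n)⁻¹ := by
  have hx : (n : ℂ) ^ (-α) ≠ 0 := by simp [Complex.cpow_eq_zero_iff, hn]
  have hf : (n.factorial : ℂ) ≠ 0 := by exact_mod_cast n.factorial_ne_zero
  have hp : ∏ j ∈ Finset.range (n + 1), (-α + j) =
      (-1) ^ (n + 1) * ∏ j ∈ Finset.range (n + 1), (α - j) := by
    have := Finset.prod_neg (s := Finset.range (n + 1)) (fun j : ℕ => α - j)
    rw [Finset.card_range] at this
    rw [← this]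
    exact Finset.prod_congr rfl fun j _ => by ring
  have hn1 : (n : ℂ) + 1 ≠ 0 := by exact_mod_cast n.succ_ne_zero
  rw [altBinom, Complex.GammaSeq, hp, Nat.factorial_succ, inv_div]
  push_cast
  field_simp

theorem summable_norm_altBinom {α : ℂ} (hα : 0 < α.re) : Summable fun k => ‖altBinom α k‖ := by
  -- For α = m the point -α is a pole of Γ and Euler's limit cannot be inverted, but then the
  -- coefficients vanish for k > m.
  by_cases h : ∃ m : ℕ, α = m
  · obtain ⟨m, rfl⟩ := h
    refine summable_of_ne_finset_zero (s := Finset.range (m + 1)) fun k hk => ?_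
    have : ∏ j ∈ Finset.range k, ((m : ℂ) - j) = 0 :=
      Finset.prod_eq_zero (i := m) (by simp at hk ⊢; omega) (sub_self _)
    simp [altBinom, this]
  · push Not at h
    have hΓ : Complex.Gamma (-α) ≠ 0 :=
      Complex.Gamma_ne_zero fun m hm => h m (neg_injective hm)
    have hlim := ((Complex.GammaSeq_tendsto_Gamma (-α)).inv₀ hΓ).norm
    rw [← summable_nat_add_iff 1]
    have hO : (fun n : ℕ => ‖altBinom α (n + 1)‖) =O[atTop] fun n : ℕ => (n : ℝ) ^ (-α.re - 1) := by
      have h1 := hlim.isBigO_one ℝ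
      have h2 : (fun n : ℕ => (n : ℝ) ^ (-α.re - 1) * ‖(Complex.GammaSeq (-α) n)⁻¹‖) =O[atTop]
          fun n : ℕ => (n : ℝ) ^ (-α.re - 1) * 1 := (Asymptotics.isBigO_refl _ _).mul h1
      simp only [mul_one] at h2
      refine Asymptotics.IsBigO.trans (Asymptotics.IsBigO.of_bound 1 ?_) h2
      filter_upwards [eventually_gt_atTop 0] with n hn
      have hn' : (0 : ℝ) < n := by exact_mod_cast hn
      rw [altBinom_succ_eq α hn.ne', one_mul, norm_norm, norm_mul, norm_mul, norm_norm, norm_div]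
      gcongr
      rw [Complex.norm_natCast_cpow_of_pos hn, Complex.neg_re, Real.rpow_sub hn', Real.rpow_one,
        Real.norm_of_nonneg (by positivity)]
      gcongr
      have : ‖(n : ℂ) + 1‖ = n + 1 := by
        rw [← Nat.cast_succ, Complex.norm_natCast]; simp
      linarith
    refine summable_of_isBigO_nat ?_ hO
    exact Real.summable_nat_rpow.2 (by linarith)

theorem summable_altBinom_mul_pow {α : ℂ} (hα : 0 < α.re) {z : ℂ} (hz : ‖z‖ ≤ 1) :
    Summable fun k => ‖altBinom α k * z ^ k‖ := by
  refine (summable_norm_altBinom hα).of_nonneg_of_le (fun _ => norm_nonneg _) fun k => ?_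
  rw [norm_mul, norm_pow]
  exact mul_le_of_le_one_right (norm_nonneg _) (pow_le_one₀ (norm_nonneg _) hz)

theorem re_lt_one_of_norm_le_one {z : ℂ} (hz : ‖z‖ ≤ 1) (h1 : z ≠ 1) : z.re < 1 := by
  refine lt_of_le_of_ne ((Complex.re_le_norm z).trans hz) fun h => h1 ?_
  have h2 := Complex.sq_norm z
  rw [Complex.normSq_apply] at h2
  have h3 : z.im = 0 := by nlinarith [norm_nonneg z, sq_nonneg z.im]
  exact Complex.ext (by simpa using h) (by simpa using h3)

/-- Abel's argument: take the identity at rz and let r ↑ 1. The series passes to the limit by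
absolute summability of the coefficients, the power because 1 - z lies in the open right half plane,
off the branch cut. -/
theorem hasSum_altBinom {α : ℂ} (hα : 0 < α.re) {z : ℂ} (hz : ‖z‖ ≤ 1) (h1 : z ≠ 1) :
    HasSum (fun k => altBinom α k * z ^ k) ((1 - z) ^ α) := by
  have hs := (summable_altBinom_mul_pow hα hz).of_norm
  suffices h : ∑' k, altBinom α k * z ^ k = (1 - z) ^ α from h ▸ hs.hasSum
  have hr := re_lt_one_of_norm_le_one hz h1
  have l1 : Tendsto (fun r : ℝ => ∑' k, altBinom α k * ((r : ℂ) * z) ^ k) (𝓝[<] 1)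
      (𝓝 (∑' k, altBinom α k * z ^ k)) := by
    refine tendsto_tsum_of_dominated_convergence (summable_norm_altBinom hα) (fun k => ?_) ?_
    · have : Continuous fun r : ℝ => altBinom α k * ((r : ℂ) * z) ^ k := by fun_prop
      simpa using (this.tendsto 1).mono_left nhdsWithin_le_nhds
    · filter_upwards [Ioo_mem_nhdsLT (show (0 : ℝ) < 1 by norm_num)] with r hr k
      rw [norm_mul, norm_pow, norm_mul, Complex.norm_real, Real.norm_of_nonneg hr.1.le]
      exact mul_le_of_le_one_right (norm_nonneg _)
        (pow_le_one₀ (by have := hr.1; positivity) (mul_le_one₀ hr.2.le (norm_nonneg _) hz))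
  have l2 : Tendsto (fun r : ℝ => (1 - (r : ℂ) * z) ^ α) (𝓝[<] 1) (𝓝 ((1 - z) ^ α)) := by
    have hc : ContinuousAt (fun w : ℂ => w ^ α) (1 - z) :=
      (continuousAt_cpow_const (Or.inl (by simpa using hr)))
    have : Continuous fun r : ℝ => 1 - (r : ℂ) * z := by fun_prop
    have h3 := (this.tendsto 1).mono_left (nhdsWithin_le_nhds (s := Set.Iio 1))
    simp only [Complex.ofReal_one, one_mul] at h3
    exact hc.tendsto.comp h3
  refine tendsto_nhds_unique (l1.congr' ?_) l2
  filter_upwards [Ioo_mem_nhdsLT (show (0 : ℝ) < 1 by norm_num)] with r hr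
  refine (hasSum_altBinom_of_norm_lt_one α ?_).tsum_eq
  rw [norm_mul, Complex.norm_real, Real.norm_of_nonneg hr.1.le]
  nlinarith [hr.1, hr.2, norm_nonneg z]

/-! ### The Laplace transform of a complex power -/

theorem norm_cpow_mul_exp_neg {a s : ℂ} {t : ℝ} (ht : 0 < t) :
    ‖(t : ℂ) ^ a * Complex.exp (-(s * t))‖ = t ^ a.re * Real.exp (-(s.re * t)) := by
  rw [norm_mul, Complex.norm_cpow_eq_rpow_re_of_pos ht, Complex.norm_exp]
  simp

theorem integrableOn_rpow_mul_exp {a r : ℝ} (ha : -1 < a) (hr : 0 < r) :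
    IntegrableOn (fun t : ℝ => t ^ a * Real.exp (-(r * t))) (Set.Ioi 0) := by
  simpa using integrableOn_rpow_mul_exp_neg_mul_rpow ha one_pos hr

theorem aestronglyMeasurable_cpow_mul_exp (a s : ℂ) :
    AEStronglyMeasurable (fun t : ℝ => (t : ℂ) ^ a * Complex.exp (-(s * t)))
      (volume.restrict (Set.Ioi 0)) :=
  (by fun_prop : Measurable fun t : ℝ => (t : ℂ) ^ a * Complex.exp (-(s * t))).aestronglyMeasurable

theorem integrableOn_cpow_mul_exp {a s : ℂ} (ha : -1 < a.re) (hs : 0 < s.re) :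
    IntegrableOn (fun t : ℝ => (t : ℂ) ^ a * Complex.exp (-(s * t))) (Set.Ioi 0) := by
  refine (integrableOn_rpow_mul_exp ha hs).mono' (aestronglyMeasurable_cpow_mul_exp a s) ?_
  filter_upwards [ae_restrict_mem measurableSet_Ioi] with t ht
  rw [norm_cpow_mul_exp_neg ht]

theorem differentiableOn_integral_cpow_mul_exp {a : ℂ} (ha : -1 < a.re) :
    DifferentiableOn ℂ (fun s : ℂ => ∫ t in Set.Ioi (0 : ℝ), (t : ℂ) ^ a * Complex.exp (-(s * t)))
      {s | 0 < s.re} := by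
  intro s hs
  have hs' : 0 < s.re := hs
  refine (hasDerivAt_integral_of_dominated_loc_of_deriv_le
    (μ := volume.restrict (Set.Ioi 0)) (x₀ := s)
    (F := fun s t => (t : ℂ) ^ a * Complex.exp (-(s * t)))
    (F' := fun s t => (t : ℂ) ^ a * (Complex.exp (-(s * t)) * -(t : ℂ)))
    -- Halving the real part leaves a neighbourhood of `s` on which one exponential dominates; the
    -- extra power of t comes from the derivative.
    (bound := fun t => t ^ (a.re + 1) * Real.exp (-(s.re / 2 * t)))
    (s := {w : ℂ | s.re / 2 < w.re}) ?_ ?_ (integrableOn_cpow_mul_exp ha hs) ?_ ?_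
    (integrableOn_rpow_mul_exp (by linarith) (by linarith))
    ?_).2.differentiableAt.differentiableWithinAt
  · exact (isOpen_lt continuous_const Complex.continuous_re).mem_nhds (by simp; linarith)
  · exact Eventually.of_forall fun w => aestronglyMeasurable_cpow_mul_exp a w
  · exact (by fun_prop : Measurable fun t : ℝ =>
      (t : ℂ) ^ a * (Complex.exp (-(s * t)) * -(t : ℂ))).aestronglyMeasurable
  · filter_upwards [ae_restrict_mem measurableSet_Ioi] with t ht w hw
    have ht' : 0 < t := ht
    rw [← mul_assoc, norm_mul, norm_cpow_mul_exp_neg ht, norm_neg, Complex.norm_real,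
      Real.norm_of_nonneg ht'.le, Real.rpow_add_one ht'.ne']
    have : Real.exp (-(w.re * t)) ≤ Real.exp (-(s.re / 2 * t)) := by
      rw [Real.exp_le_exp]
      have := mul_le_mul_of_nonneg_right (le_of_lt hw) ht'.le
      linarith
    calc _ = t ^ a.re * t * Real.exp (-(w.re * t)) := by ring
      _ ≤ _ := by gcongr
  · refine Eventually.of_forall fun t w _ => ?_
    have h : HasDerivAt (fun w : ℂ => -(w * (t : ℂ))) (-(t : ℂ)) w := by
      simpa using! ((hasDerivAt_id w).mul_const (t : ℂ)).neg
    exact h.cexp.const_mul _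

/-- Both sides are analytic in the right half plane and agree for real s > 0, which accumulates at
1, so the identity theorem applies. -/
theorem integral_cpow_mul_exp_neg_mul {a s : ℂ} (ha : 0 < a.re) (hs : 0 < s.re) :
    ∫ t in Set.Ioi (0 : ℝ), (t : ℂ) ^ (a - 1) * Complex.exp (-(s * t)) =
      s ^ (-a) * Complex.Gamma a := by
  have hopen : IsOpen {s : ℂ | 0 < s.re} := isOpen_lt continuous_const Complex.continuous_re
  have h1 := (differentiableOn_integral_cpow_mul_exp (a := a - 1) (by simpa using ha)).analyticOnNhd
    hopen
  have h2 : AnalyticOnNhd ℂ (fun s : ℂ => s ^ (-a) * Complex.Gamma a) {s | 0 < s.re} := by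
    refine DifferentiableOn.analyticOnNhd (fun w hw => ?_) hopen
    exact ((differentiableAt_id.cpow_const (Or.inl hw)).mul_const _).differentiableWithinAt
  refine h1.eqOn_of_preconnected_of_frequently_eq h2
    (convex_halfSpace_re_gt 0).isPreconnected (z₀ := 1) (by simp) ?_ hs
  have hl : Tendsto (fun r : ℝ => (r : ℂ)) (𝓝[≠] 1) (𝓝[≠] 1) := by
    refine tendsto_nhdsWithin_iff.2 ⟨?_, ?_⟩
    · exact (Complex.continuous_ofReal.tendsto' 1 1 (by simp)).mono_left nhdsWithin_le_nhds
    · filter_upwards [self_mem_nhdsWithin] with r hr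
      simpa using hr
  refine hl.frequently (Eventually.frequently ?_)
  filter_upwards [mem_nhdsWithin_of_mem_nhds (lt_mem_nhds (zero_lt_one' ℝ))] with r hr
  rw [Complex.integral_cpow_mul_exp_neg_mul_Ioi ha hr, one_div, Complex.cpow_neg,
    Complex.inv_cpow]
  rw [Complex.arg_ofReal_of_nonneg hr.le]
  exact Real.pi_pos.ne

/-! ### Truncated powers with complex exponent -/

/-- The truncated power `t₊ ^ β` with complex exponent. -/
def cTruncPow (β : ℂ) (t : ℝ) : ℂ := if 0 < t then (t : ℂ) ^ β else 0

theorem cTruncPow_of_nonpos (β : ℂ) {t : ℝ} (ht : t ≤ 0) : cTruncPow β t = 0 :=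
  if_neg ht.not_gt

theorem continuous_cTruncPow {β : ℂ} (hβ : 0 < β.re) : Continuous (cTruncPow β) := by
  have h : cTruncPow β = fun t : ℝ => ((max t 0 : ℝ) : ℂ) ^ β := by
    ext t
    by_cases ht : 0 < t
    · rw [cTruncPow, if_pos ht, max_eq_left ht.le]
    · rw [cTruncPow, if_neg ht, max_eq_right (not_lt.1 ht), Complex.ofReal_zero, Complex.zero_cpow]
      rintro rfl
      simp at hβ
  rw [h]
  refine continuous_iff_continuousAt.2 fun t => ?_
  exact (Complex.continuousAt_ofReal_cpow_const _ β (Or.inl hβ)).comp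
    (f := fun t : ℝ => max t 0) (by fun_prop)

theorem norm_cTruncPow_le (β : ℂ) {t : ℝ} : ‖cTruncPow β t‖ ≤ |t| ^ β.re := by
  unfold cTruncPow
  split_ifs with ht
  · rw [Complex.norm_cpow_eq_rpow_re_of_pos ht, abs_of_pos ht]
  · rw [norm_zero]; positivity

theorem cTruncPow_mul_exp_eq_indicator (β s : ℂ) :
    (fun t : ℝ => cTruncPow β t * Complex.exp (-(s * t))) =
      (Set.Ioi 0).indicator fun t : ℝ => (t : ℂ) ^ β * Complex.exp (-(s * t)) := by
  ext t
  by_cases ht : 0 < t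
  · rw [Set.indicator_of_mem (by exact ht), cTruncPow, if_pos ht]
  · rw [Set.indicator_of_notMem (by exact ht), cTruncPow, if_neg ht, zero_mul]

theorem integrable_cTruncPow_mul_exp {β s : ℂ} (hβ : -1 < β.re) (hs : 0 < s.re) :
    Integrable fun t : ℝ => cTruncPow β t * Complex.exp (-(s * t)) := by
  rw [cTruncPow_mul_exp_eq_indicator, integrable_indicator_iff measurableSet_Ioi]
  exact integrableOn_cpow_mul_exp hβ hs

theorem integral_cTruncPow_mul_exp {α s : ℂ} (hα : 0 < α.re) (hs : 0 < s.re) :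
    ∫ t : ℝ, cTruncPow (α - 1) t * Complex.exp (-(s * t)) = s ^ (-α) * Complex.Gamma α := by
  rw [cTruncPow_mul_exp_eq_indicator, integral_indicator measurableSet_Ioi,
    integral_cpow_mul_exp_neg_mul hα hs]

/-! ### The symbol of the spline in the right half plane -/

/-- The function `(1 - e ^ (-s)) ^ α s ^ (-α)`, the Laplace transform of the spline. -/
def symb (α s : ℂ) : ℂ := (1 - Complex.exp (-s)) ^ α * s ^ (-α)

/-- Here |arg w| < π/2 and |arg z| ≤ π/2, so arg w - arg z stays in (-π, π) and the principal
logarithm is additive. -/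
theorem div_cpow_of_re_pos {w z : ℂ} (hw : 0 < w.re) (hz : 0 ≤ z.re) (hz0 : z ≠ 0) (α : ℂ) :
    (w / z) ^ α = w ^ α * z ^ (-α) := by
  have hw0 : w ≠ 0 := by rintro rfl; simp at hw
  have h1 : |w.arg| < Real.pi / 2 := Complex.abs_arg_lt_pi_div_two_iff.2 (Or.inl hw)
  have h2 : |z.arg| ≤ Real.pi / 2 := Complex.abs_arg_le_pi_div_two_iff.2 hz
  have hpi : z.arg ≠ Real.pi := by
    intro h
    rw [h, abs_of_pos Real.pi_pos] at h2
    linarith [Real.pi_pos]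
  have hinv : z⁻¹.arg = -z.arg := by rw [Complex.arg_inv, if_neg hpi]
  rw [div_eq_mul_inv, Complex.cpow_def_of_ne_zero (mul_ne_zero hw0 (inv_ne_zero hz0)),
    Complex.log_mul hw0 (inv_ne_zero hz0), Complex.log_inv _ hpi,
    Complex.cpow_def_of_ne_zero hw0, Complex.cpow_def_of_ne_zero hz0, ← Complex.exp_add]
  · congr 1; ring
  · rw [hinv]
    rw [abs_lt] at h1
    rw [abs_le] at h2
    constructor <;> linarith

theorem norm_exp_neg_le_one {s : ℂ} (hs : 0 ≤ s.re) : ‖Complex.exp (-s)‖ ≤ 1 := by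
  rw [Complex.norm_exp]
  simpa using hs

theorem re_one_sub_exp_pos {s : ℂ} (hs : 0 ≤ s.re) (h1 : Complex.exp (-s) ≠ 1) :
    0 < (1 - Complex.exp (-s)).re := by
  have := re_lt_one_of_norm_le_one (norm_exp_neg_le_one hs) h1
  simpa using this

theorem Xi_cpow_eq_symb (α : ℂ) {ξ : ℝ} (h : Complex.exp (-(Complex.I * ξ)) ≠ 1) :
    Xi ξ ^ α = symb α (Complex.I * ξ) := by
  have hξ : ξ ≠ 0 := by rintro rfl; simp at h
  rw [Xi, if_neg hξ, symb]
  exact div_cpow_of_re_pos (re_one_sub_exp_pos (by simp) h) (by simp)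
    (mul_ne_zero Complex.I_ne_zero (by exact_mod_cast hξ)) α

theorem norm_cpow_le_mul (z α : ℂ) :
    ‖z ^ α‖ ≤ Real.exp (Real.pi * |α.im|) * ‖z‖ ^ α.re := by
  refine (Complex.norm_cpow_le z α).trans ?_
  rw [div_eq_mul_inv, ← Real.exp_neg, mul_comm]
  gcongr
  calc -(z.arg * α.im) ≤ |z.arg * α.im| := neg_le_abs _
    _ = |z.arg| * |α.im| := abs_mul _ _
    _ ≤ Real.pi * |α.im| := by gcongr; exact Complex.abs_arg_le_pi z

/-- A smooth form of the bound 2 min(1, ‖s‖): the factor ‖s‖ will cancel the singularity of s^(-α)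
at 0. -/
theorem norm_one_sub_exp_le {s : ℂ} (hs : 0 ≤ s.re) :
    ‖1 - Complex.exp (-s)‖ ≤ 4 * ‖s‖ / (1 + ‖s‖) := by
  have hn := norm_nonneg s
  have h2 : ‖1 - Complex.exp (-s)‖ ≤ 2 := by
    refine (norm_sub_le _ _).trans ?_
    have := norm_exp_neg_le_one hs
    rw [norm_one]
    linarith
  rw [le_div_iff₀ (by positivity)]
  rcases le_total ‖s‖ 1 with h | h
  · have h3 : ‖1 - Complex.exp (-s)‖ ≤ 2 * ‖s‖ := by
      rw [norm_sub_rev]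
      simpa using Complex.norm_exp_sub_one_le (x := -s) (by simpa using h)
    nlinarith [norm_nonneg (1 - Complex.exp (-s))]
  · nlinarith

/-- The bound depends on `s` only through Im s, so a single function dominates the symbol on all
lines Re s = ε ≥ 0. -/
theorem norm_symb_le {α s : ℂ} (hα : 0 < α.re) (hs : 0 ≤ s.re) :
    ‖symb α s‖ ≤ Real.exp (Real.pi * |α.im|) ^ 2 * 4 ^ α.re * (1 + |s.im|) ^ (-α.re) := by
  rcases eq_or_ne s 0 with rfl | h0
  · have : α ≠ 0 := by rintro rfl; simp at hα
    rw [symb, neg_zero, Complex.exp_zero, sub_self, Complex.zero_cpow this, zero_mul, norm_zero]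
    positivity
  have hn : 0 < ‖s‖ := norm_pos_iff.2 h0
  calc ‖symb α s‖ ≤ (Real.exp (Real.pi * |α.im|) * ‖1 - Complex.exp (-s)‖ ^ α.re) *
        (Real.exp (Real.pi * |(-α).im|) * ‖s‖ ^ (-α).re) := by
        rw [symb, norm_mul]
        gcongr <;> exact norm_cpow_le_mul _ _
    _ ≤ (Real.exp (Real.pi * |α.im|) * (4 * ‖s‖ / (1 + ‖s‖)) ^ α.re) *
        (Real.exp (Real.pi * |(-α).im|) * ‖s‖ ^ (-α).re) := by
        gcongr
        exact norm_one_sub_exp_le hs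
    _ = Real.exp (Real.pi * |α.im|) ^ 2 * 4 ^ α.re * (1 + ‖s‖) ^ (-α.re) := by
        rw [Complex.neg_im, abs_neg, Complex.neg_re, Real.rpow_neg hn.le,
          Real.rpow_neg (by positivity),
          Real.div_rpow (by positivity) (by positivity), Real.mul_rpow (by norm_num) hn.le]
        have : ‖s‖ ^ α.re ≠ 0 := (Real.rpow_pos_of_pos hn _).ne'
        field_simp
    _ ≤ _ := by
        refine mul_le_mul_of_nonneg_left ?_ (by positivity)
        exact Real.rpow_le_rpow_of_nonpos (by positivity)
          (by gcongr; exact Complex.abs_im_le_norm s) (by linarith)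

/-- The exceptional points are integers. They must be left out: at 0, for instance, `Xi` is 1 while
the base 1 - e^(-s) of the symbol vanishes. -/
theorem ae_exp_ne_one : ∀ᵐ η : ℝ, Complex.exp (-(Complex.I * ((2 * Real.pi * η : ℝ) : ℂ))) ≠ 1 := by
  have hc : (Set.range ((↑) : ℤ → ℝ)).Countable := Set.countable_range _
  filter_upwards [hc.ae_notMem volume] with η hη h
  obtain ⟨n, hn⟩ := Complex.exp_eq_one_iff.1 h
  refine hη ⟨-n, ?_⟩
  have h2 : Complex.I * (2 * Real.pi) * (((-n : ℤ) : ℂ) - (η : ℂ)) = 0 := by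
    push_cast at hn ⊢
    linear_combination hn
  have h3 : Complex.I * (2 * Real.pi) ≠ 0 := by simp [Real.pi_ne_zero]
  have h4 := (mul_eq_zero.1 h2).resolve_left h3
  exact_mod_cast sub_eq_zero.1 h4

theorem continuousAt_symb (α : ℂ) {s : ℂ} (hs : 0 ≤ s.re) (h1 : Complex.exp (-s) ≠ 1)
    (hm : s ∈ Complex.slitPlane) : ContinuousAt (symb α) s := by
  refine ContinuousAt.mul ?_ (continuousAt_cpow_const hm)
  exact (continuousAt_cpow_const (Or.inl (re_one_sub_exp_pos hs h1))).comp
    (f := fun s => 1 - Complex.exp (-s)) (by fun_prop)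

theorem measurable_symb (α : ℂ) : Measurable (symb α) := by
  unfold symb
  fun_prop

theorem integrable_rpow_neg_bound {r : ℝ} (hr : 1 < r) :
    Integrable fun η : ℝ => (1 + |2 * Real.pi * η|) ^ (-r) := by
  have h := (integrable_one_add_norm (E := ℝ) (μ := volume) (r := r)
    (by simpa using hr)).comp_mul_left' (R := 2 * Real.pi) (by positivity)
  simpa using h

theorem Xi_cpow_ae_eq_symb (α : ℂ) : (fun η : ℝ => Xi (2 * Real.pi * η) ^ α) =ᵐ[volume]
    fun η : ℝ => symb α (Complex.I * ((2 * Real.pi * η : ℝ) : ℂ)) := by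
  filter_upwards [ae_exp_ne_one] with η h
  exact Xi_cpow_eq_symb α h

theorem measurable_symb_line (α : ℂ) (ε : ℝ) :
    Measurable fun η : ℝ => symb α (ε + Complex.I * ((2 * Real.pi * η : ℝ) : ℂ)) :=
  (measurable_symb α).comp (by fun_prop)

theorem norm_symb_line_le {α : ℂ} (hα : 0 < α.re) {ε : ℝ} (hε : 0 ≤ ε) (η : ℝ) :
    ‖symb α (ε + Complex.I * ((2 * Real.pi * η : ℝ) : ℂ))‖ ≤
      Real.exp (Real.pi * |α.im|) ^ 2 * 4 ^ α.re * (1 + |2 * Real.pi * η|) ^ (-α.re) := by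
  have h := norm_symb_le (s := ε + Complex.I * ((2 * Real.pi * η : ℝ) : ℂ)) hα (by simpa using hε)
  simpa only [Complex.add_im, Complex.ofReal_im, Complex.I_mul_im, Complex.ofReal_re, zero_add]
    using h

theorem integrable_symb_line {α : ℂ} (hα : 1 < α.re) {ε : ℝ} (hε : 0 ≤ ε) :
    Integrable fun η : ℝ => symb α (ε + Complex.I * ((2 * Real.pi * η : ℝ) : ℂ)) :=
  ((integrable_rpow_neg_bound hα).const_mul _).mono' (measurable_symb_line α ε).aestronglyMeasurable
    (Eventually.of_forall fun η => norm_symb_line_le (by linarith) hε η)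

theorem integrable_Xi_cpow {α : ℂ} (hα : 1 < α.re) :
    Integrable fun η : ℝ => Xi (2 * Real.pi * η) ^ α := by
  refine (integrable_symb_line hα le_rfl).congr ?_
  filter_upwards [Xi_cpow_ae_eq_symb α] with η h
  rw [h]; simp

/-- An integrable function that is essentially bounded is square integrable. -/
theorem memLp_Xi_cpow {α : ℂ} (hα : 1 < α.re) :
    MemLp (fun η : ℝ => Xi (2 * Real.pi * η) ^ α) 2 := by
  have h1 := integrable_Xi_cpow hα
  refine (memLp_two_iff_integrable_sq_norm h1.1).2
    ((h1.norm.const_mul (Real.exp (Real.pi * |α.im|) ^ 2 * 4 ^ α.re)).mono' (h1.1.norm.pow 2) ?_)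
  filter_upwards [Xi_cpow_ae_eq_symb α] with η h
  rw [norm_pow, norm_norm, sq]
  refine mul_le_mul_of_nonneg_right ?_ (norm_nonneg _)
  have h2 := norm_symb_line_le (show 0 < α.re by linarith) le_rfl η
  rw [h]
  simp only [Complex.ofReal_zero, zero_add] at h2
  refine h2.trans (mul_le_of_le_one_right (by positivity) ?_)
  exact Real.rpow_le_one_of_one_le_of_nonpos (by linarith [abs_nonneg (2 * Real.pi * η)])
    (by linarith)

/-! ### The scalar spline and its Fourier representation -/

theorem integrable_tsum_of_summable_integral_norm {ι X E : Type*} [Countable ι]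
    [MeasurableSpace X] {μ : Measure X} [NormedAddCommGroup E] {F : ι → X → E}
    (hF : ∀ i, Integrable (F i) μ) (hs : Summable fun i => ∫ x, ‖F i x‖ ∂μ)
    (hm : AEStronglyMeasurable (fun x => ∑' i, F i x) μ) :
    Integrable (fun x => ∑' i, F i x) μ := by
  refine ⟨hm, ?_⟩
  calc ∫⁻ x, ‖∑' i, F i x‖ₑ ∂μ ≤ ∫⁻ x, ∑' i, ‖F i x‖ₑ ∂μ :=
        lintegral_mono fun x => enorm_tsum_le_tsum_enorm
    _ = ∑' i, ∫⁻ x, ‖F i x‖ₑ ∂μ := lintegral_tsum fun i => (hF i).1.enorm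
    _ = ∑' i, ENNReal.ofReal (∫ x, ‖F i x‖ ∂μ) := by
        simp_rw [ofReal_integral_norm_eq_lintegral_enorm (hF _)]
    _ < ⊤ := hs.tsum_ofReal_lt_top

/-- The spline of complex order, without the factor `1 / Γ(α)`. -/
def truncSum (α : ℂ) (t : ℝ) : ℂ := ∑' k : ℕ, altBinom α k * cTruncPow (α - 1) (t - k)

theorem truncSum_eq_sum (α : ℂ) {t : ℝ} {N : ℕ} (h : t ≤ N) :
    truncSum α t = ∑ k ∈ Finset.range N, altBinom α k * cTruncPow (α - 1) (t - k) := by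
  refine tsum_eq_sum fun k hk => ?_
  have : (N : ℝ) ≤ k := by exact_mod_cast not_lt.1 fun h => hk (Finset.mem_range.2 h)
  rw [cTruncPow_of_nonpos _ (by linarith), mul_zero]

theorem continuous_truncSum {α : ℂ} (hα : 1 < α.re) : Continuous (truncSum α) := by
  refine continuous_iff_continuousAt.2 fun t => ?_
  obtain ⟨N, hN⟩ := exists_nat_gt t
  have hc : Continuous fun t : ℝ =>
      ∑ k ∈ Finset.range N, altBinom α k * cTruncPow (α - 1) (t - k) :=
    continuous_finsetSum _ fun k _ => continuous_const.mul
      ((continuous_cTruncPow (by simpa using hα)).comp (by fun_prop))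
  refine hc.continuousAt.congr ?_
  filter_upwards [Iio_mem_nhds hN] with u hu
  exact (truncSum_eq_sum α (le_of_lt hu)).symm

theorem shifted_mul_exp (β s : ℂ) (k : ℕ) (t : ℝ) :
    cTruncPow β (t - k) * Complex.exp (-(s * t)) =
      Complex.exp (-s) ^ k *
        (cTruncPow β (t - k) * Complex.exp (-(s * ((t - k : ℝ) : ℂ)))) := by
  rw [mul_left_comm, ← Complex.exp_nat_mul, ← Complex.exp_add]
  congr 2
  push_cast
  ring

theorem integrable_shifted {β s : ℂ} (hβ : -1 < β.re) (hs : 0 < s.re) (k : ℕ) :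
    Integrable fun t : ℝ => cTruncPow β (t - k) * Complex.exp (-(s * t)) := by
  simp_rw [shifted_mul_exp]
  exact ((integrable_cTruncPow_mul_exp hβ hs).comp_sub_right (k : ℝ)).const_mul _

theorem integral_shifted {α s : ℂ} (hα : 0 < α.re) (hs : 0 < s.re) (k : ℕ) :
    ∫ t : ℝ, cTruncPow (α - 1) (t - k) * Complex.exp (-(s * t)) =
      Complex.exp (-s) ^ k * (s ^ (-α) * Complex.Gamma α) := by
  simp_rw [shifted_mul_exp]
  rw [integral_const_mul, integral_sub_right_eq_self
    (fun t : ℝ => cTruncPow (α - 1) t * Complex.exp (-(s * t))), integral_cTruncPow_mul_exp hα hs]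

theorem integral_norm_shifted_le (β : ℂ) {s : ℂ} (hs : 0 < s.re) (k : ℕ) :
    ∫ t : ℝ, ‖cTruncPow β (t - k) * Complex.exp (-(s * t))‖ ≤
      ∫ t : ℝ, ‖cTruncPow β t * Complex.exp (-(s * t))‖ := by
  simp_rw [shifted_mul_exp β s k, norm_mul (Complex.exp (-s) ^ k)]
  rw [integral_const_mul, integral_sub_right_eq_self
    (fun t : ℝ => ‖cTruncPow β t * Complex.exp (-(s * t))‖), norm_pow]
  exact mul_le_of_le_one_left (integral_nonneg fun _ => norm_nonneg _)
    (pow_le_one₀ (norm_nonneg _) (norm_exp_neg_le_one hs.le))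

/-- Termwise integration turns the sum of shifts into a binomial series in e^(-s), which lies in the
open disc. It is justified because the shifted terms have L¹ norms bounded independently of k and
the coefficients are summable. -/
theorem integrable_and_integral_truncSum_mul_exp {α s : ℂ} (hα : 1 < α.re) (hs : 0 < s.re) :
    Integrable (fun t : ℝ => truncSum α t * Complex.exp (-(s * t))) ∧
      ∫ t : ℝ, truncSum α t * Complex.exp (-(s * t)) = symb α s * Complex.Gamma α := by
  have hα0 : 0 < α.re := by linarith
  set F : ℕ → ℝ → ℂ := fun k t =>
    altBinom α k * (cTruncPow (α - 1) (t - k) * Complex.exp (-(s * t))) with hF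
  have hsum : (fun t : ℝ => truncSum α t * Complex.exp (-(s * t))) = fun t => ∑' k, F k t := by
    ext t
    rw [truncSum, ← tsum_mul_right]
    exact tsum_congr fun k => mul_assoc _ _ _
  have hint : ∀ k, Integrable (F k) := fun k =>
    (integrable_shifted (by simpa using hα0) hs k).const_mul _
  have hnorm : Summable fun k => ∫ t, ‖F k t‖ := by
    refine ((summable_norm_altBinom hα0).mul_right
      (∫ t : ℝ, ‖cTruncPow (α - 1) t * Complex.exp (-(s * t))‖)).of_nonneg_of_le
      (fun k => integral_nonneg fun _ => norm_nonneg _) fun k => ?_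
    simp_rw [hF, norm_mul (altBinom α k)]
    rw [integral_const_mul]
    exact mul_le_mul_of_nonneg_left (integral_norm_shifted_le _ hs k) (norm_nonneg _)
  have hcont : Continuous fun t : ℝ => truncSum α t * Complex.exp (-(s * t)) :=
    (continuous_truncSum hα).mul (by fun_prop)
  rw [hsum] at hcont ⊢
  refine ⟨integrable_tsum_of_summable_integral_norm hint hnorm hcont.aestronglyMeasurable, ?_⟩
  rw [← integral_tsum_of_summable_integral_norm hint hnorm]
  simp_rw [hF, integral_const_mul, integral_shifted hα0 hs]
  simp_rw [← mul_assoc]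
  rw [tsum_mul_right, tsum_mul_right, symb]
  congr 2
  refine (hasSum_altBinom_of_norm_lt_one α ?_).tsum_eq
  rw [Complex.norm_exp]
  simpa using hs

/-- The Laplace transform at ε + iξ is the Fourier transform of the function damped by e^(-εt). That
function is continuous and integrable, and its transform is integrable, so inversion holds at every
point. -/
theorem fourierInv_symb_line {α : ℂ} (hα : 1 < α.re) {ε : ℝ} (hε : 0 < ε) (t : ℝ) :
    𝓕⁻ (fun η : ℝ => symb α (ε + Complex.I * ((2 * Real.pi * η : ℝ) : ℂ))) t =
      (Complex.Gamma α)⁻¹ * (truncSum α t * Complex.exp (-(ε * t))) := by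
  have hΓ : Complex.Gamma α ≠ 0 := Complex.Gamma_ne_zero_of_re_pos (by linarith)
  set f : ℝ → ℂ := fun t => (Complex.Gamma α)⁻¹ * (truncSum α t * Complex.exp (-(ε * t))) with hf
  have hfi : Integrable f :=
    (integrable_and_integral_truncSum_mul_exp (s := ε) hα (by simpa using hε)).1.const_mul _
  have hfc : Continuous f := continuous_const.mul ((continuous_truncSum hα).mul (by fun_prop))
  have hF : 𝓕 f = fun η : ℝ => symb α (ε + Complex.I * ((2 * Real.pi * η : ℝ) : ℂ)) := by
    ext η
    rw [Real.fourier_real_eq_integral_exp_smul]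
    have h := (integrable_and_integral_truncSum_mul_exp (α := α)
      (s := ε + Complex.I * ((2 * Real.pi * η : ℝ) : ℂ)) hα (by simpa using hε)).2
    rw [← mul_div_cancel_right₀ (symb α _) hΓ, ← h, div_eq_inv_mul, ← integral_const_mul]
    refine integral_congr_ae (Eventually.of_forall fun t => ?_)
    simp only [hf, smul_eq_mul]
    rw [show -((ε + Complex.I * ((2 * Real.pi * η : ℝ) : ℂ)) * (t : ℂ)) =
      ((-2 * Real.pi * t * η : ℝ) : ℂ) * Complex.I + -(ε * t) by push_cast; ring, Complex.exp_add]
    ring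
  have hFi : Integrable (𝓕 f) := hF ▸ integrable_symb_line hα hε.le
  rw [← hF, Continuous.fourierInv_fourier_eq hfc hfi hFi]

/-- The spline of complex order `α`. -/
def cSpline (α : ℂ) (t : ℝ) : ℂ := (Complex.Gamma α)⁻¹ * truncSum α t

/-- Removes the damping by dominated convergence as ε ↓ 0, so that integrability of the undamped sum
is never needed. -/
theorem fourierInv_Xi_cpow {α : ℂ} (hα : 1 < α.re) (t : ℝ) :
    𝓕⁻ (fun η : ℝ => Xi (2 * Real.pi * η) ^ α) t = cSpline α t := by
  have hα0 : 0 < α.re := by linarith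
  have l1 : Tendsto (fun ε : ℝ =>
      𝓕⁻ (fun η : ℝ => symb α (ε + Complex.I * ((2 * Real.pi * η : ℝ) : ℂ))) t) (𝓝[>] 0)
      (𝓝 (𝓕⁻ (fun η : ℝ => Xi (2 * Real.pi * η) ^ α) t)) := by
    simp only [Real.fourierInv_eq']
    refine tendsto_integral_filter_of_dominated_convergence _ ?_ ?_
      ((integrable_rpow_neg_bound hα).const_mul (Real.exp (Real.pi * |α.im|) ^ 2 * 4 ^ α.re)) ?_
    · refine Eventually.of_forall fun ε => (Continuous.aestronglyMeasurable ?_).fun_smul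
        (measurable_symb_line α ε).aestronglyMeasurable
      fun_prop
    · filter_upwards [self_mem_nhdsWithin] with ε hε
      refine Eventually.of_forall fun η => ?_
      rw [norm_smul, Complex.norm_exp_ofReal_mul_I, one_mul]
      exact norm_symb_line_le hα0 (le_of_lt hε) η
    · filter_upwards [ae_exp_ne_one] with η hη
      rw [Xi_cpow_eq_symb α hη]
      refine Tendsto.const_smul ?_ _
      have hξ : 2 * Real.pi * η ≠ 0 := by
        intro h
        simp [h] at hη
      have hc : ContinuousAt (symb α) (Complex.I * ((2 * Real.pi * η : ℝ) : ℂ)) :=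
        continuousAt_symb α (by simp) hη (Or.inr (by simpa using hξ))
      refine hc.tendsto.comp ?_
      have : Continuous fun ε : ℝ => (ε : ℂ) + Complex.I * ((2 * Real.pi * η : ℝ) : ℂ) := by
        fun_prop
      exact (this.tendsto' 0 _ (by simp)).mono_left nhdsWithin_le_nhds
  have l2 : Tendsto (fun ε : ℝ => (Complex.Gamma α)⁻¹ * (truncSum α t * Complex.exp (-(ε * t))))
      (𝓝[>] 0) (𝓝 (cSpline α t)) := by
    have : Continuous fun ε : ℝ =>
        (Complex.Gamma α)⁻¹ * (truncSum α t * Complex.exp (-(ε * t))) := by fun_prop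
    exact (this.tendsto' 0 _ (by simp [cSpline])).mono_left nhdsWithin_le_nhds
  refine tendsto_nhds_unique (l1.congr' ?_) l2
  filter_upwards [self_mem_nhdsWithin] with ε hε
  exact fourierInv_symb_line hα hε t

/-! ### Splitting along the complex subalgebra generated by the axis -/

theorem toHC_one : toHC 1 = 1 := by
  ext <;> simp [toHC]

theorem toHC_zero : toHC 0 = 0 := by
  ext <;> simp [toHC]

theorem toHC_add (p r : ℍ[ℝ]) : toHC (p + r) = toHC p + toHC r := by
  ext <;> simp

theorem toHC_neg (p : ℍ[ℝ]) : toHC (-p) = -toHC p := by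
  ext <;> simp

theorem toHC_mul (p r : ℍ[ℝ]) : toHC (p * r) = toHC p * toHC r := by
  ext <;> simp

theorem toHC_sub (p r : ℍ[ℝ]) : toHC (p - r) = toHC p - toHC r := by
  ext <;> simp

theorem smul_mul_eq (x : ℂ) (p r : ℍ[ℂ]) : (x • p) * r = x • (p * r) := by
  ext <;> simp <;> ring

theorem mul_smul_eq (x : ℂ) (p r : ℍ[ℂ]) : p * (x • r) = x • (p * r) := by
  ext <;> simp <;> ring

/-- The quaternionic unit `i`. -/
def unitI : ℍ[ℝ] := (⟨0, 1, 0, 0⟩ : QuaternionAlgebra ℝ (-1) 0 (-1))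

@[simp] theorem unitI_re : unitI.re = 0 := rfl

@[simp] theorem unitI_imI : unitI.imI = 1 := rfl

@[simp] theorem unitI_imJ : unitI.imJ = 0 := rfl

@[simp] theorem unitI_imK : unitI.imK = 0 := rfl

theorem toHC_smul (x : ℝ) (p : ℍ[ℝ]) : toHC (x • p) = (x : ℂ) • toHC p :=
  Quaternion.ext _ _ (Complex.ofReal_mul _ _) (Complex.ofReal_mul _ _) (Complex.ofReal_mul _ _)
    (Complex.ofReal_mul _ _)

/-- The element of the subalgebra `ℂ[U]`, `U ^ 2 = -1`, on which the two characters `U ↦ i` and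
`U ↦ -i` take the values `c` and `d`. -/
def split (U : ℍ[ℂ]) (c d : ℂ) : ℍ[ℂ] :=
  ((c + d) / 2) • (1 : ℍ[ℂ]) + (Complex.I * (d - c) / 2) • U

variable {U : ℍ[ℂ]}

/-- For U² = -1 the two fixed elements are complementary idempotents. Sums, integrals and norm
bounds thereby reduce to the scalar coordinates. -/
theorem split_eq_add (U : ℍ[ℂ]) (c d : ℂ) : split U c d = c • split U 1 0 + d • split U 0 1 := by
  simp only [split, smul_add, smul_smul]
  module

theorem smul_split (x c d : ℂ) : x • split U c d = split U (x * c) (x * d) := by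
  simp only [split]
  module

theorem split_self (c : ℂ) : split U c c = c • (1 : ℍ[ℂ]) := by
  simp only [split]
  module

theorem split_zero : split U 0 0 = 0 := by rw [split_self, zero_smul]

theorem split_one : split U 1 1 = 1 := by rw [split_self, one_smul]

theorem split_mul (hU : U * U = -1) (c d c' d' : ℂ) :
    split U c d * split U c' d' = split U (c * c') (d * d') := by
  simp only [split, add_mul, mul_add, smul_mul_eq, mul_smul_eq, mul_one, one_mul, hU, smul_neg]
  rw [smul_smul, smul_smul, smul_smul, smul_smul]
  match_scalars
  · linear_combination (-(d - c) * (d' - c') / 4) * Complex.I_mul_I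
  · ring

theorem exists_axis (q : ℍ[ℝ]) : ∃ u : ℍ[ℝ], u * u = -1 ∧
    (q.im = 0 ∨ u = axis q) ∧ q = (q.re : ℝ) • (1 : ℍ[ℝ]) + ‖q.im‖ • u := by
  by_cases h : q.im = 0
  -- For v = 0 the axis is 0, not a square root of -1; any imaginary unit serves, since its
  -- coefficient vanishes.
  · refine ⟨unitI, ?_, Or.inl h, ?_⟩
    · ext <;> simp
    · rw [h, norm_zero, zero_smul, add_zero]
      have h1 : q.imI = 0 := congrArg QuaternionAlgebra.imI h
      have h2 : q.imJ = 0 := congrArg QuaternionAlgebra.imJ h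
      have h3 : q.imK = 0 := congrArg QuaternionAlgebra.imK h
      ext <;> simp [h1, h2, h3]
  · have hn : ‖q.im‖ ≠ 0 := norm_ne_zero_iff.2 h
    refine ⟨axis q, ?_, Or.inr rfl, ?_⟩
    · have hN : ‖q.im‖ * ‖q.im‖ = q.imI * q.imI + q.imJ * q.imJ + q.imK * q.imK := by
        rw [← Quaternion.normSq_eq_norm_mul_self, Quaternion.normSq_def']
        simp
        ring
      have h1 : q.im * q.im = (-(‖q.im‖ * ‖q.im‖)) • (1 : ℍ[ℝ]) := by
        rw [hN]
        ext <;> simp <;> ring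
      rw [axis, smul_mul_smul_comm, h1, smul_smul]
      rw [show ‖q.im‖⁻¹ * ‖q.im‖⁻¹ * -(‖q.im‖ * ‖q.im‖) = -1 by field_simp]
      simp
    · rw [axis, smul_smul, mul_inv_cancel₀ hn, one_smul]
      ext <;> simp

/-- `α = a + i |v|` for `q = a + v`. -/
def expo (q : ℍ[ℝ]) : ℂ := q.re + ‖q.im‖ * Complex.I

@[simp] theorem expo_re (q : ℍ[ℝ]) : (expo q).re = q.re := by simp [expo]

theorem expo_conj (q : ℍ[ℝ]) : conj (expo q) = q.re - ‖q.im‖ * Complex.I := by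
  simp [expo, sub_eq_add_neg]

/-- `U` is an imaginary unit such that `q` belongs to `ℝ[U]`. -/
structure IsAxis (q : ℍ[ℝ]) (U : ℍ[ℂ]) : Prop where
  mul_self : U * U = -1
  eq_axis : q.im = 0 ∨ U = toHC (axis q)
  toHC_eq : toHC q = split U (expo q) (conj (expo q))

theorem exists_isAxis (q : ℍ[ℝ]) : ∃ U, IsAxis q U := by
  obtain ⟨u, h1, h2, h3⟩ := exists_axis q
  refine ⟨toHC u, by rw [← toHC_mul, h1, toHC_neg, toHC_one], h2.imp_right (congrArg _), ?_⟩
  conv_lhs => rw [h3]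
  rw [toHC_add, toHC_smul, toHC_smul, toHC_one, split, expo_conj, expo]
  congr 2
  · ring
  · linear_combination (‖q.im‖ : ℂ) * Complex.I_mul_I

theorem IsAxis.smul_add_smul {q : ℍ[ℝ]} (h : IsAxis q U) {x y : ℂ} (hy : ‖q.im‖ = 0 → y = 0) :
    x • (1 : ℍ[ℂ]) + y • toHC (axis q) = split U (x + Complex.I * y) (x - Complex.I * y) := by
  have : y • toHC (axis q) = y • U := by
    rcases h.eq_axis with h | h
    · rw [hy (by rw [h, norm_zero]), zero_smul, zero_smul]
    · rw [h]
  rw [this, split]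
  congr 2
  · ring
  · linear_combination y * Complex.I_mul_I

theorem sub_one_im (q : ℍ[ℝ]) : (q - 1).im = q.im := by
  ext <;> simp

theorem axis_sub_one (q : ℍ[ℝ]) : axis (q - 1) = axis q := by
  rw [axis, axis, sub_one_im]

theorem expo_sub_one (q : ℍ[ℝ]) : expo (q - 1) = expo q - 1 := by
  rw [expo, expo, sub_one_im]
  simp
  ring

/-- By Euler's formula the two characters turn the cosine and sine into exp(±i|v| log z), which
combines with z^a. -/
theorem IsAxis.qpow_eq {q : ℍ[ℝ]} (h : IsAxis q U) {z : ℂ} (hz : z ≠ 0) :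
    qpow z q = split U (z ^ expo q) (z ^ conj (expo q)) := by
  rw [qpow, h.smul_add_smul (fun hq => by rw [hq]; simp), smul_split]
  have e1 : ∀ w : ℂ, Complex.cos w + Complex.I * Complex.sin w = Complex.exp (w * Complex.I) :=
    fun w => by rw [Complex.exp_mul_I]; ring
  have e2 : ∀ w : ℂ, Complex.cos w - Complex.I * Complex.sin w = Complex.exp (-w * Complex.I) :=
    fun w => by rw [Complex.exp_mul_I, Complex.cos_neg, Complex.sin_neg]; ring
  rw [e1, e2, Complex.cpow_def_of_ne_zero hz, Complex.cpow_def_of_ne_zero hz,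
    Complex.cpow_def_of_ne_zero hz, ← Complex.exp_add, ← Complex.exp_add, expo_conj, expo]
  congr 2 <;> ring

/-- Covers z = 0 too, where all the powers vanish; `Xi` does take the value 0, at the nonzero
multiples of 2π. -/
theorem IsAxis.qpow_eq_of_re_pos {q : ℍ[ℝ]} (h : IsAxis q U) (hq : 0 < q.re) (z : ℂ) :
    qpow z q = split U (z ^ expo q) (z ^ conj (expo q)) := by
  rcases eq_or_ne z 0 with rfl | hz
  · have h0 : expo q ≠ 0 := fun h0 => by
      have := congrArg Complex.re h0
      simp at this
      linarith
    have h1 : (q.re : ℂ) ≠ 0 := by exact_mod_cast hq.ne'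
    rw [qpow, Complex.zero_cpow h0, Complex.zero_cpow h1, zero_smul,
      Complex.zero_cpow (by simpa using h0), split_zero]
  · exact h.qpow_eq hz

theorem IsAxis.sub_one {q : ℍ[ℝ]} (h : IsAxis q U) : IsAxis (q - 1) U where
  mul_self := h.mul_self
  eq_axis := by rw [sub_one_im, axis_sub_one]; exact h.eq_axis
  toHC_eq := by
    rw [toHC_sub, toHC_one, h.toHC_eq, expo_sub_one,
      ← split_one (U := U), map_sub, map_one]
    simp only [split]
    module

theorem IsAxis.truncPow_eq {q : ℍ[ℝ]} (h : IsAxis q U) (t : ℝ) :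
    truncPow t (q - 1) = split U (cTruncPow (expo q - 1) t) (cTruncPow (conj (expo q) - 1) t) := by
  unfold truncPow cTruncPow
  split_ifs with ht
  · rw [h.sub_one.qpow_eq (by exact_mod_cast ht.ne'), expo_sub_one, map_sub, map_one]
  · rw [split_zero]

theorem IsAxis.qpoch_eq {q : ℍ[ℝ]} (h : IsAxis q U) (k : ℕ) :
    toHC (qpoch q k) = split U (∏ j ∈ Finset.range k, (expo q - j))
      (∏ j ∈ Finset.range k, (conj (expo q) - j)) := by
  induction k with
  | zero => rw [qpoch, toHC_one, Finset.prod_range_zero, Finset.prod_range_zero, split_one]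
  | succ k ih =>
    have hk : toHC (k : ℍ[ℝ]) = split U k k := by
      rw [split_self]
      ext <;> simp
    have hs : split U (expo q) (conj (expo q)) - split U k k =
        split U (expo q - k) (conj (expo q) - k) := by
      simp only [split]
      module
    rw [qpoch, toHC_mul, ih, toHC_sub, hk, h.toHC_eq, hs,
      split_mul h.mul_self, Finset.prod_range_succ, Finset.prod_range_succ]

theorem IsAxis.coeff_eq {q : ℍ[ℝ]} (h : IsAxis q U) (k : ℕ) :
    coeff q k = split U (altBinom (expo q) k) (altBinom (conj (expo q)) k) := by
  have h1 : ((-1) ^ k : ℍ[ℝ]) * qchoose q k = ((-1 : ℝ) ^ k * (k.factorial : ℝ)⁻¹) • qpoch q k := by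
    rw [qchoose, mul_smul]
    rcases neg_one_pow_eq_or ℝ k with h | h <;> rcases Nat.even_or_odd k with hk | hk <;>
      simp [hk.neg_one_pow]
  rw [coeff, h1, toHC_smul, h.qpoch_eq, smul_split, altBinom, altBinom]
  push_cast
  simp only [mul_assoc]

theorem re_add_mul_I (x y : ℝ) : ((x : ℂ) + y * Complex.I).re = x := by simp

theorem im_add_mul_I (x y : ℝ) : ((x : ℂ) + y * Complex.I).im = y := by simp

/-- The cosine and sine integrals are the real and imaginary parts of Γ(α), and Γ commutes with
conjugation. -/
theorem IsAxis.qGamma_eq {q : ℍ[ℝ]} (h : IsAxis q U) (hq : 0 < q.re) :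
    toHC (qGamma q) = split U (Complex.Gamma (expo q)) (Complex.Gamma (conj (expo q))) := by
  set f : ℝ → ℂ := fun t => (t : ℂ) ^ (expo q - 1) * Complex.exp (-(1 * (t : ℂ))) with hf
  have hint : IntegrableOn f (Set.Ioi 0) := integrableOn_cpow_mul_exp (by simpa using hq) (by simp)
  have hΓ : Complex.Gamma (expo q) = ∫ t in Set.Ioi (0 : ℝ), f t := by
    rw [hf, integral_cpow_mul_exp_neg_mul (by simpa using hq) (by simp)]
    simp
  have hfe : ∀ t : ℝ, t ∈ Set.Ioi (0 : ℝ) → f t =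
      ((t ^ (q.re - 1) * Real.cos (‖q.im‖ * Real.log t) * Real.exp (-t) : ℝ) : ℂ) +
      ((t ^ (q.re - 1) * Real.sin (‖q.im‖ * Real.log t) * Real.exp (-t) : ℝ) : ℂ) * Complex.I := by
    intro t ht
    have ht0 : (t : ℂ) ≠ 0 := by exact_mod_cast (ne_of_gt ht)
    have e : expo q - 1 = ((q.re - 1 : ℝ) : ℂ) + ‖q.im‖ * Complex.I := by
      rw [expo]; push_cast; ring
    rw [hf, e]
    simp only
    rw [Complex.cpow_add _ _ ht0, ← Complex.ofReal_cpow (le_of_lt ht),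
      Complex.cpow_def_of_ne_zero ht0, ← Complex.ofReal_log (le_of_lt ht),
      show (Real.log t : ℂ) * (‖q.im‖ * Complex.I) = ((‖q.im‖ * Real.log t : ℝ) : ℂ) * Complex.I by
        push_cast; ring, Complex.exp_mul_I, one_mul]
    push_cast
    ring
  have hre : ∫ t in Set.Ioi (0 : ℝ), t ^ (q.re - 1) * Real.cos (‖q.im‖ * Real.log t) * Real.exp (-t)
      = (Complex.Gamma (expo q)).re := by
    rw [hΓ, ← Complex.reCLM_apply, ← Complex.reCLM.integral_comp_comm hint]
    refine setIntegral_congr_fun measurableSet_Ioi fun t ht => ?_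
    simp only [hfe t ht, Complex.reCLM_apply, re_add_mul_I]
  have him : ∫ t in Set.Ioi (0 : ℝ), t ^ (q.re - 1) * Real.sin (‖q.im‖ * Real.log t) * Real.exp (-t)
      = (Complex.Gamma (expo q)).im := by
    rw [hΓ, ← Complex.imCLM_apply, ← Complex.imCLM.integral_comp_comm hint]
    refine setIntegral_congr_fun measurableSet_Ioi fun t ht => ?_
    simp only [hfe t ht, Complex.imCLM_apply, im_add_mul_I]
  have h0 : ‖q.im‖ = 0 → ((Complex.Gamma (expo q)).im : ℂ) = 0 := by
    intro h0
    rw [← him, h0]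
    simp
  rw [qGamma, hre, him, toHC_add, toHC_smul, toHC_smul, toHC_one, h.smul_add_smul h0,
    Complex.Gamma_conj]
  congr 1
  · rw [mul_comm, Complex.re_add_im]
  · apply Complex.ext <;> simp

theorem IsAxis.inv_qGamma_eq {q : ℍ[ℝ]} (h : IsAxis q U) (hq : 0 < q.re) :
    toHC (qGamma q)⁻¹ =
      split U (Complex.Gamma (expo q))⁻¹ (Complex.Gamma (conj (expo q)))⁻¹ := by
  have hΓ : Complex.Gamma (expo q) ≠ 0 := Complex.Gamma_ne_zero_of_re_pos (by simpa using hq)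
  have hΓ' : Complex.Gamma (conj (expo q)) ≠ 0 :=
    Complex.Gamma_ne_zero_of_re_pos (by simpa using hq)
  have h1 : toHC (qGamma q) *
      split U (Complex.Gamma (expo q))⁻¹ (Complex.Gamma (conj (expo q)))⁻¹ = 1 := by
    rw [h.qGamma_eq hq, split_mul h.mul_self, mul_inv_cancel₀ hΓ, mul_inv_cancel₀ hΓ', split_one]
  have hne : qGamma q ≠ 0 := by
    intro h0
    rw [h0, toHC_zero, zero_mul] at h1
    have := congrArg QuaternionAlgebra.re h1
    simp at this
  have h2 : toHC (qGamma q)⁻¹ * toHC (qGamma q) = 1 := by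
    rw [← toHC_mul, inv_mul_cancel₀ hne, toHC_one]
  exact left_inv_eq_right_inv h2 h1

/-! ### Tempered distributions given by functions -/

theorem IsGivenBy.congr_ae {T : 𝓢'(ℝ, ℍ[ℂ])} {f g : ℝ → ℍ[ℂ]} (hf : IsGivenBy T f)
    (h : f =ᵐ[volume] g) : IsGivenBy T g := by
  intro φ
  have hφ : (fun x => φ x • f x) =ᵐ[volume] fun x => φ x • g x := by
    filter_upwards [h] with x hx
    rw [hx]
  exact ⟨(hf φ).1.congr hφ, (hf φ).2.trans (integral_congr_ae hφ)⟩

theorem isGivenBy_toTemperedDistribution (B : L2HC) : IsGivenBy (B : 𝓢'(ℝ, ℍ[ℂ])) B := by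
  intro φ
  refine ⟨?_, Lp.toTemperedDistribution_apply B φ⟩
  exact memLp_one_iff_integrable.1 ((Lp.memLp B).smul (p := 2) (r := 1) (φ.memLp 2))

theorem IsGivenBy.locallyIntegrable {T : 𝓢'(ℝ, ℍ[ℂ])} {f : ℝ → ℍ[ℂ]} (hf : IsGivenBy T f) :
    LocallyIntegrable f := by
  intro x
  let b : ContDiffBump x := ⟨1, 2, one_pos, one_lt_two⟩
  have hc : HasCompactSupport (Complex.ofRealCLM ∘ b) := b.hasCompactSupport.comp_left rfl
  have hs : ContDiff ℝ (⊤ : ℕ∞) (Complex.ofRealCLM ∘ b) :=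
    Complex.ofRealCLM.contDiff.comp b.contDiff
  refine ⟨Metric.closedBall x 1, Metric.closedBall_mem_nhds x one_pos, ?_⟩
  refine (hf (hc.toSchwartzMap hs)).1.integrableOn.congr_fun (fun y hy => ?_)
    -- A bump function equal to 1 on the ball, used as test function, gives integrability there.
    measurableSet_closedBall
  have : b y = 1 := b.one_of_mem_closedBall hy
  simp [this]

theorem IsGivenBy.ae_eq {T : 𝓢'(ℝ, ℍ[ℂ])} {f g : ℝ → ℍ[ℂ]} (hf : IsGivenBy T f)
    (hg : IsGivenBy T g) : f =ᵐ[volume] g := by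
  have h0 : ∀ᵐ x : ℝ, f x - g x = 0 := by
    refine ae_eq_zero_of_integral_contDiff_smul_eq_zero
      (hf.locallyIntegrable.sub hg.locallyIntegrable) fun ψ hψ hψc => ?_
    have hc : HasCompactSupport (Complex.ofRealCLM ∘ ψ) := hψc.comp_left rfl
    have hs : ContDiff ℝ (⊤ : ℕ∞) (Complex.ofRealCLM ∘ ψ) := Complex.ofRealCLM.contDiff.comp hψ
    have h1 := hf (hc.toSchwartzMap hs)
    have h2 := hg (hc.toSchwartzMap hs)
    have h3 : ∫ x, ((hc.toSchwartzMap hs) x • f x - (hc.toSchwartzMap hs) x • g x) = 0 := by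
      rw [integral_sub h1.1 h2.1, ← h1.2, ← h2.2, sub_self]
    rw [← h3]
    exact integral_congr_ae (Eventually.of_forall fun x => smul_sub (ψ x : ℂ) (f x) (g x))
  filter_upwards [h0] with x hx
  exact sub_eq_zero.1 hx

theorem integral_fourierInv_smul_eq {φ : ℝ → ℂ} {g : ℝ → ℍ[ℂ]} (hφ : Integrable φ)
    (hg : Integrable g) : ∫ η, 𝓕⁻ φ η • g η = ∫ t, φ t • 𝓕⁻ g t := by
  have hL : Continuous fun p : ℝ × ℝ => (-innerₗ ℝ : ℝ →ₗ[ℝ] ℝ →ₗ[ℝ] ℝ) p.1 p.2 := by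
    simp only [LinearMap.neg_apply, innerₗ_apply_apply]
    fun_prop
  have h := VectorFourier.integral_fourierIntegral_smul_eq_flip (μ := volume) (ν := volume)
    (L := (-innerₗ ℝ : ℝ →ₗ[ℝ] ℝ →ₗ[ℝ] ℝ)) Real.continuous_fourierChar hL hφ hg
  have hflip : (-innerₗ ℝ : ℝ →ₗ[ℝ] ℝ →ₗ[ℝ] ℝ).flip = -innerₗ ℝ := by
    ext
    simp
  rw [hflip] at h
  exact h

theorem norm_fourierInv_le (g : ℝ → ℍ[ℂ]) (t : ℝ) : ‖𝓕⁻ g t‖ ≤ ∫ η, ‖g η‖ :=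
  VectorFourier.norm_fourierIntegral_le_integral_norm _ _ _ _ _

theorem continuous_fourierInv {g : ℝ → ℍ[ℂ]} (hg : Integrable g) : Continuous (𝓕⁻ g) := by
  have hL : Continuous fun p : ℝ × ℝ => (-innerₗ ℝ : ℝ →ₗ[ℝ] ℝ →ₗ[ℝ] ℝ) p.1 p.2 := by
    simp only [LinearMap.neg_apply, innerₗ_apply_apply]
    fun_prop
  exact VectorFourier.fourierIntegral_continuous Real.continuous_fourierChar hL hg

/-- An `L²` function with integrable Fourier transform is the inverse Fourier integral of it. -/
theorem ae_eq_fourierInv {B : L2HC} {g : ℝ → ℍ[ℂ]} (hB : (⇑(𝓕 B : L2HC)) =ᵐ[volume] g)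
    (hg : Integrable g) : ⇑B =ᵐ[volume] 𝓕⁻ g := by
  refine (isGivenBy_toTemperedDistribution B).ae_eq fun φ => ⟨?_, ?_⟩
  · refine (φ.integrable.norm.mul_const (∫ η, ‖g η‖)).mono'
      (φ.continuous.smul (continuous_fourierInv hg)).aestronglyMeasurable ?_
    refine Eventually.of_forall fun t => ?_
    rw [norm_smul]
    gcongr
    exact norm_fourierInv_le g t
  -- Duality moves the inverse transform to the test function; Fubini then moves it back to the
  -- integrable function `g`.
  · have h1 : (B : 𝓢'(ℝ, ℍ[ℂ])) = 𝓕⁻ ((𝓕 B : L2HC) : 𝓢'(ℝ, ℍ[ℂ])) := by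
      rw [Lp.fourierInv_toTemperedDistribution_eq, FourierTransform.fourierInv_fourier_eq]
    rw [h1, TemperedDistribution.fourierInv_apply,
      ((isGivenBy_toTemperedDistribution (𝓕 B : L2HC)).congr_ae hB _).2, SchwartzMap.fourierInv_coe]
    exact integral_fourierInv_smul_eq φ.integrable hg

theorem hasTemperateGrowth_weight (m : ℕ) :
    Function.HasTemperateGrowth fun x : ℝ => ((1 + x ^ 2 : ℝ) : ℂ) ^ m := by
  push_cast
  fun_prop

/-- Dividing by the polynomial weight gives an L^∞ function, hence a tempered distribution, which is
then multiplied by the weight. -/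
theorem exists_isGivenBy {f : ℝ → ℍ[ℂ]} (hm : AEStronglyMeasurable f volume) {C : ℝ} {m : ℕ}
    (hb : ∀ x, ‖f x‖ ≤ C * (1 + x ^ 2) ^ m) : ∃ T : 𝓢'(ℝ, ℍ[ℂ]), IsGivenBy T f := by
  set w : ℝ → ℂ := fun x => ((1 + x ^ 2 : ℝ) : ℂ) ^ m with hw
  have hpos : ∀ x : ℝ, 0 < 1 + x ^ 2 := fun x => by positivity
  have hw0 : ∀ x, w x ≠ 0 := fun x => pow_ne_zero _ (by exact_mod_cast (hpos x).ne')
  have hwn : ∀ x, ‖w x‖ = (1 + x ^ 2) ^ m := fun x => by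
    rw [hw, norm_pow, Complex.norm_real, Real.norm_of_nonneg (hpos x).le]
  have hwt : w.HasTemperateGrowth := hasTemperateGrowth_weight m
  have hwc : Continuous w := by fun_prop
  have hh : MemLp (fun x => (w x)⁻¹ • f x) ⊤ := by
    refine memLp_top_of_bound ((hwc.inv₀ hw0).aestronglyMeasurable.smul hm) C
      (Eventually.of_forall fun x => ?_)
    rw [norm_smul, norm_inv, hwn, inv_mul_le_iff₀ (by have := hpos x; positivity), mul_comm]
    exact hb x
  set H : Lp ℍ[ℂ] ⊤ (volume : Measure ℝ) := hh.toLp with hH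
  refine ⟨TemperedDistribution.smulLeftCLM ℍ[ℂ] w (H : 𝓢'(ℝ, ℍ[ℂ])), fun φ => ?_⟩
  have hae : (fun x => SchwartzMap.smulLeftCLM ℂ w φ x • H x) =ᵐ[volume]
      fun x => φ x • f x := by
    filter_upwards [hh.coeFn_toLp] with x hx
    rw [hx, SchwartzMap.smulLeftCLM_apply_apply hwt, smul_smul, smul_eq_mul, mul_right_comm,
      mul_inv_cancel₀ (hw0 x), one_mul]
  refine ⟨?_, ?_⟩
  · refine Integrable.congr ?_ hae
    exact memLp_one_iff_integrable.1 ((Lp.memLp H).smul (p := 1) (r := 1)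
      ((SchwartzMap.smulLeftCLM ℂ w φ).memLp 1))
  · rw [TemperedDistribution.smulLeftCLM_apply_apply, Lp.toTemperedDistribution_apply]
    exact integral_congr_ae hae

theorem hasSum_temperedDistribution_iff {U : ℕ → 𝓢'(ℝ, ℍ[ℂ])} {T : 𝓢'(ℝ, ℍ[ℂ])} :
    HasSum U T ↔ ∀ φ : 𝓢(ℝ, ℂ), HasSum (fun k => U k φ) (T φ) := by
  have h : ∀ (s : Finset ℕ) (φ : 𝓢(ℝ, ℂ)), (∑ k ∈ s, U k) φ = ∑ k ∈ s, U k φ := fun s φ =>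
    map_sum (PointwiseConvergenceCLM.evalCLM (RingHom.id ℂ) ℍ[ℂ] φ) U s
  simp only [HasSum]
  rw [PointwiseConvergenceCLM.tendsto_iff_forall_tendsto]
  simp only [h]

theorem hasSum_of_isGivenBy {U : ℕ → 𝓢'(ℝ, ℍ[ℂ])} {f : ℕ → ℝ → ℍ[ℂ]} {T : 𝓢'(ℝ, ℍ[ℂ])}
    {F : ℝ → ℍ[ℂ]} (hU : ∀ k, IsGivenBy (U k) (f k)) (hT : IsGivenBy T F) {D : ℕ → ℝ} {m : ℕ}
    (hD : Summable D) (hb : ∀ k x, ‖f k x‖ ≤ D k * (1 + x ^ 2) ^ m)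
    (hF : F =ᵐ[volume] fun x => ∑' k, f k x) : HasSum U T := by
  refine hasSum_temperedDistribution_iff.2 fun φ => ?_
  have hsum : Summable fun k => ∫ x, ‖φ x • f k x‖ := by
    refine (hD.mul_right (∫ x, ‖φ x‖ * (1 + x ^ 2) ^ m)).of_nonneg_of_le
      (fun k => integral_nonneg fun _ => norm_nonneg _) fun k => ?_
    rw [← integral_const_mul]
    have hi : Integrable fun x : ℝ => ‖φ x‖ * (1 + x ^ 2) ^ m := by
      refine (SchwartzMap.smulLeftCLM ℂ (fun x : ℝ => ((1 + x ^ 2 : ℝ) : ℂ) ^ m)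
        φ).integrable.norm.congr (Eventually.of_forall fun x => ?_)
      have hp : (0 : ℝ) ≤ 1 + x ^ 2 := by positivity
      simp only [SchwartzMap.smulLeftCLM_apply_apply
        (hasTemperateGrowth_weight m), smul_eq_mul, norm_mul, norm_pow,
        Complex.norm_real, Real.norm_of_nonneg hp]
      ring
    refine integral_mono (hU k φ).1.norm (hi.const_mul _) fun x => ?_
    simp only [norm_smul]
    calc ‖φ x‖ * ‖f k x‖ ≤ ‖φ x‖ * (D k * (1 + x ^ 2) ^ m) := by gcongr; exact hb k x
      _ = _ := by ring
  have h := hasSum_integral_of_summable_integral_norm (fun k => (hU k φ).1) hsum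
  have hlim : T φ = ∫ x, ∑' k, φ x • f k x := by
    rw [(hT φ).2]
    refine integral_congr_ae ?_
    filter_upwards [hF] with x hx
    have hs : Summable fun k => f k x :=
      (hD.mul_right ((1 + x ^ 2) ^ m)).of_norm_bounded fun k => hb k x
    rw [hx, hs.tsum_const_smul]
  rw [hlim]
  simpa only [(hU _ φ).2] using h

/-! ### The quaternionic spline in the time and in the frequency domain -/

variable {q : ℍ[ℝ]}

theorem norm_split_le (c d : ℂ) :
    ‖split U c d‖ ≤ ‖c‖ * ‖split U 1 0‖ + ‖d‖ * ‖split U 0 1‖ := by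
  rw [split_eq_add]
  refine (norm_add_le _ _).trans ?_
  rw [norm_smul, norm_smul]

theorem sum_split {ι : Type*} (s : Finset ι) (f g : ι → ℂ) :
    ∑ k ∈ s, split U (f k) (g k) = split U (∑ k ∈ s, f k) (∑ k ∈ s, g k) := by
  rw [split_eq_add, Finset.sum_smul, Finset.sum_smul, ← Finset.sum_add_distrib]
  exact Finset.sum_congr rfl fun k _ => split_eq_add _ _ _

theorem hasSum_split {f g : ℕ → ℂ} {c d : ℂ} (hf : HasSum f c) (hg : HasSum g d) :
    HasSum (fun k => split U (f k) (g k)) (split U c d) := by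
  simp only [split_eq_add U (f _), split_eq_add U c]
  exact (hf.smul_const _).add (hg.smul_const _)

theorem aestronglyMeasurable_split {f g : ℝ → ℂ} (hf : AEStronglyMeasurable f volume)
    (hg : AEStronglyMeasurable g volume) :
    AEStronglyMeasurable (fun x => split U (f x) (g x)) volume := by
  simp only [split_eq_add U (f _)]
  exact (hf.smul_const _).add (hg.smul_const _)

theorem integrable_split {f g : ℝ → ℂ} (hf : Integrable f) (hg : Integrable g) :
    Integrable fun x => split U (f x) (g x) := by
  simp only [split_eq_add U (f _)]
  exact (hf.smul_const _).add (hg.smul_const _)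

theorem memLp_split {f g : ℝ → ℂ} (hf : MemLp f 2) (hg : MemLp g 2) :
    MemLp (fun x => split U (f x) (g x)) 2 := by
  simp only [split_eq_add U (f _)]
  exact ((ContinuousLinearMap.toSpanSingleton ℂ (split U 1 0)).comp_memLp' hf).add
    ((ContinuousLinearMap.toSpanSingleton ℂ (split U 0 1)).comp_memLp' hg)

theorem fourierInv_split {f g : ℝ → ℂ} (hf : Integrable f) (hg : Integrable g) (t : ℝ) :
    𝓕⁻ (fun x => split U (f x) (g x)) t = split U (𝓕⁻ f t) (𝓕⁻ g t) := by
  have hi : ∀ {f : ℝ → ℂ}, Integrable f → Integrable fun v : ℝ =>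
      Complex.exp (((2 * Real.pi * inner ℝ v t : ℝ) : ℂ) * Complex.I) • f v := fun {f} hf => by
    refine hf.norm.mono' ((Continuous.aestronglyMeasurable (by fun_prop)).fun_smul hf.1) ?_
    refine Eventually.of_forall fun v => ?_
    rw [norm_smul, Complex.norm_exp_ofReal_mul_I, one_mul]
  simp only [Real.fourierInv_eq']
  rw [split_eq_add, ← integral_smul_const, ← integral_smul_const,
    ← integral_add ((hi hf).smul_const _) ((hi hg).smul_const _)]
  refine integral_congr_ae (Eventually.of_forall fun v => ?_)
  beta_reduce
  rw [smul_split, split_eq_add]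
  rfl

theorem IsAxis.bsplineHat_eq (h : IsAxis q U) (hq : 0 < q.re) (ξ : ℝ) :
    bsplineHat q ξ = split U (Xi ξ ^ expo q) (Xi ξ ^ conj (expo q)) :=
  h.qpow_eq_of_re_pos hq _

theorem memLp_bsplineHat (hq : 1 < q.re) :
    MemLp (fun η : ℝ => bsplineHat q (2 * Real.pi * η)) 2 := by
  obtain ⟨U, h⟩ := exists_isAxis q
  simp only [h.bsplineHat_eq (by linarith)]
  exact memLp_split (memLp_Xi_cpow (by simpa using hq)) (memLp_Xi_cpow (by simpa using hq))

theorem integrable_bsplineHat (hq : 1 < q.re) :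
    Integrable fun η : ℝ => bsplineHat q (2 * Real.pi * η) := by
  obtain ⟨U, h⟩ := exists_isAxis q
  simp only [h.bsplineHat_eq (by linarith)]
  exact integrable_split (integrable_Xi_cpow (by simpa using hq))
    (integrable_Xi_cpow (by simpa using hq))

theorem IsAxis.term_eq (h : IsAxis q U) (k : ℕ) (t : ℝ) :
    coeff q k * truncPow (t - k) (q - 1) =
      split U (altBinom (expo q) k * cTruncPow (expo q - 1) (t - k))
        (altBinom (conj (expo q)) k * cTruncPow (conj (expo q) - 1) (t - k)) := by
  rw [h.coeff_eq, h.truncPow_eq, split_mul h.mul_self]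

theorem term_eq_zero (q : ℍ[ℝ]) {t : ℝ} {N k : ℕ} (ht : t ≤ N) (hk : k ∉ Finset.range N) :
    coeff q k * truncPow (t - k) (q - 1) = 0 := by
  have : (N : ℝ) ≤ k := by exact_mod_cast not_lt.1 fun h => hk (Finset.mem_range.2 h)
  rw [truncPow, if_neg (by linarith), mul_zero]

theorem IsAxis.tsum_term_eq (h : IsAxis q U) (t : ℝ) :
    ∑' k : ℕ, coeff q k * truncPow (t - k) (q - 1) =
      split U (truncSum (expo q) t) (truncSum (conj (expo q)) t) := by
  obtain ⟨N, hN⟩ := exists_nat_ge t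
  rw [truncSum_eq_sum _ hN, truncSum_eq_sum _ hN, ← sum_split,
    tsum_eq_sum fun k hk => term_eq_zero q hN hk]
  exact Finset.sum_congr rfl fun k _ => h.term_eq k t

/-- The time domain representation of the quaternionic spline. -/
theorem fourierInv_bsplineHat (hq : 1 < q.re) (t : ℝ) :
    𝓕⁻ (fun η : ℝ => bsplineHat q (2 * Real.pi * η)) t =
      toHC (qGamma q)⁻¹ * ∑' k : ℕ, coeff q k * truncPow (t - k) (q - 1) := by
  obtain ⟨U, h⟩ := exists_isAxis q
  have h1 : 1 < (expo q).re := by simpa using hq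
  have h2 : 1 < (conj (expo q)).re := by simpa using hq
  simp only [h.bsplineHat_eq (show 0 < q.re by linarith)]
  rw [fourierInv_split (integrable_Xi_cpow h1) (integrable_Xi_cpow h2), fourierInv_Xi_cpow h1,
    fourierInv_Xi_cpow h2, h.inv_qGamma_eq (by linarith), h.tsum_term_eq, split_mul h.mul_self,
    cSpline, cSpline]

theorem IsBSpline.ae_eq (hq : 1 < q.re) {B : L2HC} (hB : IsBSpline q B) :
    ⇑B =ᵐ[volume] fun t : ℝ =>
      toHC (qGamma q)⁻¹ * ∑' k : ℕ, coeff q k * truncPow (t - k) (q - 1) := by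
  filter_upwards [ae_eq_fourierInv hB (integrable_bsplineHat hq)] with t ht
  rw [ht, fourierInv_bsplineHat hq]

theorem existsUnique_isBSpline (hq : 1 < q.re) : ∃! B : L2HC, IsBSpline q B := by
  refine ⟨𝓕⁻ (memLp_bsplineHat hq).toLp, ?_, fun B hB => ?_⟩
  · change (⇑(𝓕 (𝓕⁻ (memLp_bsplineHat hq).toLp : L2HC) : L2HC)) =ᵐ[volume] _
    rw [FourierTransform.fourier_fourierInv_eq]
    exact (memLp_bsplineHat hq).coeFn_toLp
  · have : (𝓕 B : L2HC) = (memLp_bsplineHat hq).toLp :=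
      Lp.ext (hB.trans (memLp_bsplineHat hq).coeFn_toLp.symm)
    rw [← this, FourierTransform.fourierInv_fourier_eq]

/-- On the support 0 < x - k ≤ x ≤ 1 + x², so the bound is uniform in k and the summable
coefficients control the series of distributions. -/
theorem norm_cTruncPow_sub_le {β : ℂ} (hβ : 0 ≤ β.re) (k : ℕ) (x : ℝ) :
    ‖cTruncPow β (x - k)‖ ≤ (1 + x ^ 2) ^ ⌈β.re⌉₊ := by
  have h1 : (1 : ℝ) ≤ 1 + x ^ 2 := by nlinarith [sq_nonneg x]
  rcases le_or_gt (x - k) 0 with h | h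
  · rw [cTruncPow_of_nonpos _ h, norm_zero]
    positivity
  · have hk : (0 : ℝ) ≤ k := k.cast_nonneg
    calc ‖cTruncPow β (x - k)‖ ≤ |x - k| ^ β.re := norm_cTruncPow_le β
      _ ≤ (1 + x ^ 2) ^ β.re := by
          refine Real.rpow_le_rpow (abs_nonneg _) ?_ hβ
          rw [abs_of_pos h]
          nlinarith [sq_nonneg (x - 1)]
      _ ≤ (1 + x ^ 2) ^ (⌈β.re⌉₊ : ℝ) := Real.rpow_le_rpow_of_exponent_le h1 (Nat.le_ceil _)
      _ = _ := Real.rpow_natCast _ _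

theorem exists_hasSum_terms (hq : 1 < q.re) {B : L2HC} (hB : IsBSpline q B) :
    ∃ T : ℕ → 𝓢'(ℝ, ℍ[ℂ]),
      (∀ k : ℕ, IsGivenBy (T k) fun t : ℝ =>
        toHC (qGamma q)⁻¹ * (coeff q k * truncPow (t - k) (q - 1))) ∧
      HasSum T (B : 𝓢'(ℝ, ℍ[ℂ])) := by
  obtain ⟨U, h⟩ := exists_isAxis q
  have hα : 0 < (expo q).re := by rw [expo_re]; linarith
  have hα' : 0 < (conj (expo q)).re := by rwa [Complex.conj_re]
  have hβ : 0 < (expo q - 1).re := by simpa using hq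
  have hβ' : 0 < (conj (expo q) - 1).re := by simpa using hq
  have hm : (conj (expo q) - 1).re = (expo q - 1).re := by simp
  have hterm : ∀ (k : ℕ) (t : ℝ), toHC (qGamma q)⁻¹ * (coeff q k * truncPow (t - k) (q - 1)) =
      split U ((Complex.Gamma (expo q))⁻¹ *
          (altBinom (expo q) k * cTruncPow (expo q - 1) (t - k)))
        ((Complex.Gamma (conj (expo q)))⁻¹ *
          (altBinom (conj (expo q)) k * cTruncPow (conj (expo q) - 1) (t - k))) := fun k t => by
    rw [h.inv_qGamma_eq (by linarith), h.term_eq, split_mul h.mul_self]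
  set D : ℕ → ℝ := fun k =>
    ‖(Complex.Gamma (expo q))⁻¹‖ * ‖altBinom (expo q) k‖ * ‖split U 1 0‖ +
      ‖(Complex.Gamma (conj (expo q)))⁻¹‖ * ‖altBinom (conj (expo q)) k‖ * ‖split U 0 1‖ with hD
  have hDs : Summable D :=
    (((summable_norm_altBinom hα).mul_left _).mul_right _).add
      (((summable_norm_altBinom hα').mul_left _).mul_right _)
  have hb : ∀ (k : ℕ) (t : ℝ), ‖toHC (qGamma q)⁻¹ * (coeff q k * truncPow (t - k) (q - 1))‖ ≤
      D k * (1 + t ^ 2) ^ ⌈(expo q - 1).re⌉₊ := by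
    intro k t
    have e1 := norm_cTruncPow_sub_le hβ.le k t
    have e2 := norm_cTruncPow_sub_le hβ'.le k t
    rw [hm] at e2
    rw [hterm]
    refine (norm_split_le _ _).trans ?_
    simp only [norm_mul, hD]
    calc _ ≤ ‖(Complex.Gamma (expo q))⁻¹‖ *
          (‖altBinom (expo q) k‖ * (1 + t ^ 2) ^ ⌈(expo q - 1).re⌉₊) * ‖split U 1 0‖ +
        ‖(Complex.Gamma (conj (expo q)))⁻¹‖ *
          (‖altBinom (conj (expo q)) k‖ * (1 + t ^ 2) ^ ⌈(expo q - 1).re⌉₊) *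
            ‖split U 0 1‖ := by gcongr
      _ = _ := by ring
  have hmeas : ∀ k : ℕ, AEStronglyMeasurable (fun t : ℝ =>
      toHC (qGamma q)⁻¹ * (coeff q k * truncPow (t - k) (q - 1))) volume := by
    intro k
    simp only [hterm]
    have c1 := (continuous_cTruncPow hβ).comp (continuous_sub_right (k : ℝ))
    have c2 := (continuous_cTruncPow hβ').comp (continuous_sub_right (k : ℝ))
    exact aestronglyMeasurable_split
      (continuous_const.mul (continuous_const.mul c1)).aestronglyMeasurable
      (continuous_const.mul (continuous_const.mul c2)).aestronglyMeasurable
  choose T hT using fun k => exists_isGivenBy (hmeas k) (hb k)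
  refine ⟨T, hT, hasSum_of_isGivenBy hT (isGivenBy_toTemperedDistribution B) hDs hb ?_⟩
  filter_upwards [hB.ae_eq hq] with t ht
  obtain ⟨N, hN⟩ := exists_nat_ge t
  rw [ht, tsum_eq_sum fun k hk => term_eq_zero q hN hk, Finset.mul_sum, tsum_eq_sum fun k hk => ?_]
  rw [term_eq_zero q hN hk, mul_zero]

/-! ### The distributional differential equation -/

theorem summable_norm_coeff (hq : 0 < q.re) : Summable fun k => ‖coeff q k‖ := by
  obtain ⟨U, h⟩ := exists_isAxis q
  refine (((summable_norm_altBinom (α := expo q) (by simpa using hq)).mul_right ‖split U 1 0‖).add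
    ((summable_norm_altBinom (α := conj (expo q)) (by simpa using hq)).mul_right
      ‖split U 0 1‖)).of_nonneg_of_le
    (fun _ => norm_nonneg _) fun k => ?_
  rw [h.coeff_eq]
  exact norm_split_le _ _

/-- Point evaluations have norm at most 1 on bounded continuous functions, so the series converges
absolutely in operator norm. This makes the limit of the Dirac series continuous. -/
theorem exists_hasSum_eval_smul {E : Type*} [NormedAddCommGroup E] [NormedSpace ℂ E]
    [CompleteSpace E] (x : ℕ → ℝ) {c : ℕ → E} (hc : Summable fun k => ‖c k‖) :
    ∃ S : BoundedContinuousFunction ℝ ℂ →L[ℂ] E, ∀ f, HasSum (fun k => f (x k) • c k) (S f) := by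
  set L : ℕ → BoundedContinuousFunction ℝ ℂ →L[ℂ] E := fun k =>
    (ContinuousLinearMap.toSpanSingleton ℂ (c k)).comp
      (BoundedContinuousFunction.evalCLM ℂ (x k)) with hL
  have hLf : ∀ k f, L k f = f (x k) • c k := fun k f => by simp [hL]
  have hb : ∀ k, ‖L k‖ ≤ ‖c k‖ := fun k => by
    refine ContinuousLinearMap.opNorm_le_bound _ (norm_nonneg _) fun f => ?_
    rw [hLf, norm_smul, mul_comm]
    gcongr
    exact f.norm_coe_le_norm _
  have hs : Summable L := hc.of_norm_bounded hb
  refine ⟨∑' k, L k, fun f => ?_⟩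
  simpa only [ContinuousLinearMap.apply_apply, hLf] using
    hs.hasSum.mapL (ContinuousLinearMap.apply ℂ E f)

theorem exists_hasSum_diracAt (hq : 0 < q.re) :
    ∃ T : 𝓢'(ℝ, ℍ[ℂ]), HasSum (fun k : ℕ => diracAt (k : ℝ) (coeff q k)) T := by
  obtain ⟨S, hS⟩ := exists_hasSum_eval_smul (fun k : ℕ => (k : ℝ)) (summable_norm_coeff hq)
  refine ⟨ContinuousLinearMap.toPointwiseConvergenceCLM _ _ _ _
    (S.comp (SchwartzMap.toBoundedContinuousFunctionCLM ℂ ℝ ℂ)), ?_⟩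
  rw [hasSum_temperedDistribution_iff]
  exact fun φ => hS (SchwartzMap.toBoundedContinuousFunctionCLM ℂ ℝ ℂ φ)

/-- The function `(1 - e ^ (-iξ)) ^ α`. -/
def diffSymb (α : ℂ) (ξ : ℝ) : ℂ := (1 - Complex.exp (-(Complex.I * ξ))) ^ α

theorem integrable_smul_diffSymb {α : ℂ} (hα : 0 < α.re) (φ : 𝓢(ℝ, ℂ)) :
    Integrable fun η : ℝ => φ η * diffSymb α (2 * Real.pi * η) := by
  refine (φ.integrable.norm.mul_const (Real.exp (Real.pi * |α.im|) * 2 ^ α.re)).mono'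
    (Measurable.aestronglyMeasurable ?_) (Eventually.of_forall fun η => ?_)
  · have := φ.continuous.measurable
    unfold diffSymb
    fun_prop
  · rw [norm_mul]
    gcongr
    refine (norm_cpow_le_mul _ _).trans ?_
    gcongr
    refine (norm_sub_le _ _).trans ?_
    have := norm_exp_neg_le_one (s := Complex.I * ((2 * Real.pi * η : ℝ) : ℂ)) (by simp)
    rw [norm_one]
    linarith

/-- The transform of δ_k is the k-th power of e^(-2πiη). Summable coefficients allow summation under
the integral, and the binomial series on the circle, valid off z = 1, identifies the sum. -/
theorem IsAxis.isGivenBy_fourier (h : IsAxis q U) (hq : 0 < q.re) {T : 𝓢'(ℝ, ℍ[ℂ])}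
    (hT : HasSum (fun k : ℕ => diracAt (k : ℝ) (coeff q k)) T) :
    IsGivenBy (𝓕 T) fun η => split U (diffSymb (expo q) (2 * Real.pi * η))
      (diffSymb (conj (expo q)) (2 * Real.pi * η)) := by
  have hα : 0 < (expo q).re := by simpa using hq
  have hα' : 0 < (conj (expo q)).re := by simpa using hq
  intro φ
  refine ⟨?_, ?_⟩
  · simp only [smul_split]
    exact integrable_split (integrable_smul_diffSymb hα φ) (integrable_smul_diffSymb hα' φ)
  set z : ℝ → ℂ := fun η => Complex.exp (-(Complex.I * ((2 * Real.pi * η : ℝ) : ℂ))) with hz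
  have hzc : Continuous z := by fun_prop
  have hzn : ∀ η, ‖z η‖ ≤ 1 := fun η => norm_exp_neg_le_one (by simp)
  set F : ℕ → ℝ → ℍ[ℂ] := fun k η => (φ η * z η ^ k) • coeff q k with hF
  have hmul : ∀ k, Integrable fun η => φ η * z η ^ k := fun k => by
    refine φ.integrable.norm.mono' (φ.continuous.mul (hzc.pow k)).aestronglyMeasurable
      (Eventually.of_forall fun η => ?_)
    rw [norm_mul, norm_pow]
    exact mul_le_of_le_one_right (norm_nonneg _) (pow_le_one₀ (norm_nonneg _) (hzn η))
  have hFi : ∀ k, Integrable (F k) := fun k => (hmul k).smul_const _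
  have hFs : Summable fun k => ∫ η, ‖F k η‖ := by
    refine ((summable_norm_coeff hq).mul_left (∫ η, ‖φ η‖)).of_nonneg_of_le
      (fun k => integral_nonneg fun _ => norm_nonneg _) fun k => ?_
    rw [← integral_mul_const]
    refine integral_mono (hFi k).norm (φ.integrable.norm.mul_const _) fun η => ?_
    simp only [hF, norm_smul, norm_mul, norm_pow]
    gcongr
    exact mul_le_of_le_one_right (norm_nonneg _) (pow_le_one₀ (norm_nonneg _) (hzn η))
  have hint := hasSum_integral_of_summable_integral_norm hFi hFs
  have hterm : ∀ k : ℕ, ∫ η, F k η = diracAt (k : ℝ) (coeff q k) (𝓕 φ) := by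
    intro k
    rw [diracAt_apply, SchwartzMap.fourier_coe, Real.fourier_real_eq_integral_exp_smul,
      ← integral_smul_const]
    refine integral_congr_ae (Eventually.of_forall fun η => ?_)
    simp only [hF, hz, smul_eq_mul]
    rw [← Complex.exp_nat_mul, mul_comm (φ η)]
    congr 3
    push_cast
    ring
  simp only [hterm] at hint
  rw [TemperedDistribution.fourier_apply,
    (hasSum_temperedDistribution_iff.1 hT (𝓕 φ)).unique hint]
  refine integral_congr_ae ?_
  filter_upwards [ae_exp_ne_one] with η hη
  have s1 := (hasSum_altBinom hα (hzn η) hη).mul_left (φ η)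
  have s2 := (hasSum_altBinom hα' (hzn η) hη).mul_left (φ η)
  rw [smul_split]
  refine Eq.trans (tsum_congr fun k => ?_) (hasSum_split s1 s2).tsum_eq
  simp only [hF]
  rw [h.coeff_eq, smul_split]
  congr 1 <;> ring

theorem cpow_mul_symb {α z : ℂ} (hz : z ≠ 0) :
    z ^ α * symb α z = (1 - Complex.exp (-z)) ^ α := by
  rw [symb, mul_left_comm, ← Complex.cpow_add _ _ hz, add_neg_cancel, Complex.cpow_zero, mul_one]

theorem I_mul_ne_zero_of_exp_ne_one {ξ : ℝ} (h : Complex.exp (-(Complex.I * ξ)) ≠ 1) :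
    Complex.I * (ξ : ℂ) ≠ 0 := by
  intro h0
  simp [h0] at h

theorem IsAxis.qpow_mul_bsplineHat (h : IsAxis q U) (hq : 0 < q.re) {ξ : ℝ}
    (hξ : Complex.exp (-(Complex.I * ξ)) ≠ 1) :
    qpow (Complex.I * (ξ : ℂ)) q * bsplineHat q ξ =
      split U (diffSymb (expo q) ξ) (diffSymb (conj (expo q)) ξ) := by
  have hz := I_mul_ne_zero_of_exp_ne_one hξ
  rw [h.qpow_eq hz, h.bsplineHat_eq hq, Xi_cpow_eq_symb _ hξ, Xi_cpow_eq_symb _ hξ,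
    split_mul h.mul_self, cpow_mul_symb hz, cpow_mul_symb hz, diffSymb, diffSymb]

theorem IsAxis.qpow_mul_left_cancel (h : IsAxis q U) {z : ℂ} (hz : z ≠ 0) {x y : ℍ[ℂ]}
    (hxy : qpow z q * x = qpow z q * y) : x = y := by
  have hinv : split U (z ^ (-expo q)) (z ^ (-conj (expo q))) * qpow z q = 1 := by
    rw [h.qpow_eq hz, split_mul h.mul_self, ← Complex.cpow_add _ _ hz, ← Complex.cpow_add _ _ hz,
      neg_add_cancel, neg_add_cancel, Complex.cpow_zero, split_one]
  rw [← one_mul x, ← hinv, mul_assoc, hxy, ← mul_assoc, hinv, one_mul]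

/-- Both conditions prescribe the Fourier transform of `B` almost everywhere, because a distribution
determines its function almost everywhere and (iξ)^q can be cancelled off a null set. -/
theorem isBSpline_iff_solvesDeltaEquation (hq : 1 < q.re) (B : L2HC) :
    IsBSpline q B ↔ SolvesDeltaEquation q (B : 𝓢'(ℝ, ℍ[ℂ])) := by
  obtain ⟨U, h⟩ := exists_isAxis q
  have hq0 : 0 < q.re := by linarith
  have hB := isGivenBy_toTemperedDistribution (𝓕 B : L2HC)
  rw [← Lp.fourier_toTemperedDistribution_eq] at hB
  constructor
  · intro hBS
    obtain ⟨T, hT⟩ := exists_hasSum_diracAt hq0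
    refine ⟨T, hT, fun η => bsplineHat q (2 * Real.pi * η), hB.congr_ae hBS,
      (h.isGivenBy_fourier hq0 hT).congr_ae ?_⟩
    filter_upwards [ae_exp_ne_one] with η hη
    rw [h.qpow_mul_bsplineHat hq0 hη]
  · rintro ⟨T, hT, g, hg, hg'⟩
    filter_upwards [hB.ae_eq hg, hg'.ae_eq (h.isGivenBy_fourier hq0 hT), ae_exp_ne_one]
      with η h1 h2 hη
    rw [h1]
    refine h.qpow_mul_left_cancel (I_mul_ne_zero_of_exp_ne_one hη) ?_
    rw [h2, h.qpow_mul_bsplineHat hq0 hη]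

end QuatSpline

end

theorem theorem5p1 (q : ℍ[ℝ]) (hq : 1 < q.re) :
    (∃! B : QuatSpline.L2HC, QuatSpline.IsBSpline q B) ∧
    ∀ B : QuatSpline.L2HC,
      (QuatSpline.IsBSpline q B →
        -- the time domain representation, in `L²`
        (⇑B =ᵐ[volume] fun t : ℝ =>
          QuatSpline.toHC (QuatSpline.qGamma q)⁻¹ *
            ∑' k : ℕ, QuatSpline.coeff q k * QuatSpline.truncPow (t - k) (q - 1)) ∧
        -- the time domain representation, in the sense of distributions
        (∃ U : ℕ → 𝓢'(ℝ, ℍ[ℂ]),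
          (∀ k : ℕ, QuatSpline.IsGivenBy (U k) fun t : ℝ =>
            QuatSpline.toHC (QuatSpline.qGamma q)⁻¹ *
              (QuatSpline.coeff q k * QuatSpline.truncPow (t - k) (q - 1))) ∧
          HasSum U (B : 𝓢'(ℝ, ℍ[ℂ]))) ∧
        -- the representation by backward differences
        (⇑B =ᵐ[volume] fun t : ℝ =>
          QuatSpline.toHC (QuatSpline.qGamma q)⁻¹ *
            QuatSpline.nabla q (fun s : ℝ => QuatSpline.truncPow s (q - 1)) t)) ∧
      -- the distributional differential equation
      (QuatSpline.IsBSpline q B ↔ QuatSpline.SolvesDeltaEquation q (B : 𝓢'(ℝ, ℍ[ℂ]))) := by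
  refine ⟨QuatSpline.existsUnique_isBSpline hq, fun B => ⟨fun hB => ?_,
    QuatSpline.isBSpline_iff_solvesDeltaEquation hq B⟩⟩
  -- The backward difference formula is the time domain formula with `nabla` unfolded.
  exact ⟨hB.ae_eq hq, QuatSpline.exists_hasSum_terms hq hB, hB.ae_eq hq⟩
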